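/- Let $\Omega=\{(x,y)\in\mathbb{R}^2 : x^2+y^2>1,\ y>0\}$ and $\mathcal{E}=\{x\in\mathbb{R} : |x|>1\}$. Let $v\in W^{1,2}(\mathcal{E})$ be real-valued; then $v$ has a representative that is continuous on $\overline{\mathcal{E}}$, again denoted by $v$. Consider the mixed problem $$ \begin{cases} \dfrac{\partial^2\psi}{\partial x^2}(x,y)+\dfrac{\partial^2\psi}{\partial y^2}(x,y)=0 & (x^2+y^2>1,\ y>0),\\[2mm] \dfrac{\partial\psi}{\partial r}(x,y)=0 & (x^2+y^2=1,\ y>0),\\[2mm] \psi(x,0)=v(x) & (|x|>1), \end{cases} \qquad \frac{\partial\psi}{\partial r}=\frac{x}{\sqrt{x^2+y^2}}\frac{\partial\psi}{\partial x}+\frac{y}{\sqrt{x^2+y^2}}\frac{\partial\psi}{\partial y}. $$ This problem has a unique solution $\psi=D_\Omega v$ in the class of functions that are continuous and bounded on $\overline\Omega$, and $$ (D_\Omega v)(x,y)= \begin{cases} \dfrac1\pi\displaystyle\int_{\mathcal{E}}\left[\frac{y}{(x-\tilde x)^2+y^2}+\frac{y}{(x\tilde x-1)^2+y^2\tilde x^2}\right]v(\tilde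 x)\,d\tilde x & ((x,y)\in\overline\Omega,\ y>0),\\[2mm] v(x) & (x\in\overline{\mathcal{E}},\ y=0). \end{cases} $$ Here $D_\Omega v$ satisfies the condition $\partial\psi/\partial r=0$ both classically ($\psi$ is differentiable, relative to $\overline\Omega$, at every point of the open half-circle) and weakly, i.e. for every $\varphi\in C_c^\infty((0,\pi))$ the function $r\mapsto\int_0^\pi\psi(r\cos\theta,r\sin\theta)\varphi(\theta)\,d\theta$ on $[1,\infty)$ has derivative $0$ at $r=1$; uniqueness holds whichever of the two senses is used. Moreover, let $\eta(x)=v(x)$ for $|x|\ge1$, $\eta(x)=v(1/x)$ for $0<|x|<1$, $\eta(0)=0$, and let $\tilde\psi(x,y)=\frac1\pi\int_{\mathbb{R}}\frac{y}{(x-\tilde x)^2+y^2}\,\eta(\tilde x)\,d\tilde x$ for $y>0$, $\tilde\psi(x,0)=\eta(x)$. Then $D_\Omega v=\tilde\psi$ on $\overline\Omega$, and $\tilde\psi(x,y)=(D_\Omega v)\left(\frac{x}{x^2+y^2},\frac{y}{x^2+y^2}\right)$ whenever $y\ge0$ and $0<x^2+y^2<1$. -/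

import Mathlib

open MeasureTheory Set InnerProductSpace
open scoped ContDiff

noncomputable section

namespace FloatingBody

/-- The free surface `{x ∈ ℝ : |x| > 1}`. -/
def freeSurface : Set ℝ := {x | 1 < |x|}

/-- The fluid domain `{(x, y) : x² + y² > 1, y > 0}`; a point `(x, y)` is the complex number
`x + i y`. -/
def fluidDomain : Set ℂ := {z | 1 < z.re ^ 2 + z.im ^ 2 ∧ 0 < z.im}

/-- The open half-circle `{(x, y) : x² + y² = 1, y > 0}`. -/
def halfCircle : Set ℂ := {z | z.re ^ 2 + z.im ^ 2 = 1 ∧ 0 < z.im}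

/-- `v` represents an element of the Sobolev space `W^{1,2}(U)`, for `U ⊆ ℝ` open: `v` and its
weak derivative are square integrable on `U`. -/
def MemW12 (U : Set ℝ) (v : ℝ → ℝ) : Prop :=
  MemLp v 2 (volume.restrict U) ∧
    ∃ g : ℝ → ℝ, MemLp g 2 (volume.restrict U) ∧
      ∀ φ : ℝ → ℝ, ContDiff ℝ ∞ φ → HasCompactSupport φ → tsupport φ ⊆ U →
        ∫ x in U, v x * deriv φ x = -∫ x in U, g x * φ x

/-- The radial derivative `(x/r) ∂ψ/∂x + (y/r) ∂ψ/∂y`, `r = √(x² + y²)`, of a function on the closed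
fluid domain. -/
def radialDeriv (ψ : ℂ → ℝ) (z : ℂ) : ℝ :=
  z.re / √(z.re ^ 2 + z.im ^ 2) * fderivWithin ℝ ψ (closure fluidDomain) z 1 +
    z.im / √(z.re ^ 2 + z.im ^ 2) * fderivWithin ℝ ψ (closure fluidDomain) z Complex.I

/-- `ψ` is continuous and bounded on the closed fluid domain. -/
def ContinuousBounded (ψ : ℂ → ℝ) : Prop :=
  ContinuousOn ψ (closure fluidDomain) ∧ ∃ C : ℝ, ∀ z ∈ closure fluidDomain, |ψ z| ≤ C

/-- The homogeneous Neumann condition on the half-circle in the classical sense. -/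
def ClassicalNeumann (ψ : ℂ → ℝ) : Prop :=
  ∀ z ∈ halfCircle, DifferentiableWithinAt ℝ ψ (closure fluidDomain) z ∧ radialDeriv ψ z = 0

/-- The homogeneous Neumann condition on the half-circle in the weak sense: the radial derivative
at `r = 1` vanishes after integration against any test function of the angle `θ ∈ (0, π)`. -/
def WeakNeumann (ψ : ℂ → ℝ) : Prop :=
  ∀ φ : ℝ → ℝ, ContDiff ℝ ∞ φ → HasCompactSupport φ → tsupport φ ⊆ Ioo 0 Real.pi →
    HasDerivWithinAt
      (fun r : ℝ => ∫ θ in (0 : ℝ)..Real.pi,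
        ψ ⟨r * Real.cos θ, r * Real.sin θ⟩ * φ θ) 0 (Ici 1) 1

/-- Bounded continuous classical solutions of the mixed problem with trace `v`. -/
structure IsClassicalSolution (v : ℝ → ℝ) (ψ : ℂ → ℝ) : Prop where
  continuousBounded : ContinuousBounded ψ
  harmonic : HarmonicOnNhd ψ fluidDomain
  neumann : ClassicalNeumann ψ
  trace : ∀ x ∈ freeSurface, ψ (x : ℂ) = v x

/-- Bounded continuous solutions of the mixed problem with trace `v`, where the Neumann condition
is understood in the weak sense. -/
structure IsWeakSolution (v : ℝ → ℝ) (ψ : ℂ → ℝ) : Prop where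
  continuousBounded : ContinuousBounded ψ
  harmonic : HarmonicOnNhd ψ fluidDomain
  neumann : WeakNeumann ψ
  trace : ∀ x ∈ freeSurface, ψ (x : ℂ) = v x

/-- The explicit formula with the Poisson-type kernel; only its values on the closed fluid domain
are meaningful. -/
def dirichletOmega (v : ℝ → ℝ) (z : ℂ) : ℝ :=
  if 0 < z.im then
    (1 / Real.pi) * ∫ t in freeSurface,
      (z.im / ((z.re - t) ^ 2 + z.im ^ 2) +
        z.im / ((z.re * t - 1) ^ 2 + z.im ^ 2 * t ^ 2)) * v t
  else v z.re

/-- The symmetric extension of `v` from `|x| ≥ 1` to the real line through `x ↦ 1 / x`. -/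
def symmExtension (v : ℝ → ℝ) (x : ℝ) : ℝ :=
  if 1 ≤ |x| then v x else if x = 0 then 0 else v (1 / x)

/-- The Poisson extension of `η` to the closed upper half-plane. -/
def dirichletHalfPlane (η : ℝ → ℝ) (z : ℂ) : ℝ :=
  if 0 < z.im then
    ∫ t : ℝ, z.im / (Real.pi * ((z.re - t) ^ 2 + z.im ^ 2)) * η t
  else η z.re

end FloatingBody

end

/-! Existence rests on a reflection. The extension `symmExtension w` is invariant under `x ↦ 1 / x`
away from `0`, and the inversion `z ↦ z / |z|²` preserves the upper half-plane. Folding the Poisson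
integral over `|t| < 1` onto `|t| > 1` by `t = 1 / s` yields the stated kernel
(`dirichletOmega_eq_dirichletHalfPlane`), and the inversion swaps its two summands
(`dirichletOmega_inversion`). Hence `f r = ψ (r z)`, with `|z| = 1`, satisfies `f r = f (1 / r)`, so
`f' 1 = 0`. Since `ψ` is harmonic across the half-circle, both Neumann conditions follow, the weak
one by differentiating under the integral. The only bad point of the extended datum is `0`, which is
not in the closed fluid domain. The Sobolev hypothesis serves only to supply a bounded continuous
trace.

Uniqueness is a maximum principle for the difference of two solutions. The exponential map carries
the half-strip `s ≥ 0`, `0 ≤ θ ≤ π` onto the closed fluid domain, the sides `θ = 0, π` onto the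
closed free surface and the edge `s = 0` onto the closed half-circle. Subtracting `ε * stripBarrier`
controls infinity and makes the `s`-derivative strictly positive on the edge, so no maximum lies
there; the mean value property excludes the interior (`le_add_stripBarrier`). In the weak case,
convolution in `θ` first turns the tested Neumann condition into a pointwise one
(`verticalMollify`), at a cost made small by uniform continuity. -/

namespace FloatingBody

/-! ### Bounded continuous representatives of `W^{1,2}` functions on a half-line -/

/-- A function on `ℝ` that is orthogonal to the derivatives of all test functions supported in
`(a, ∞)` is almost everywhere constant there. -/
theorem exists_ae_eq_const_of_integral_mul_deriv_eq_zero {V : ℝ → ℝ} {a : ℝ}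
    (hV : LocallyIntegrable V volume)
    (h : ∀ φ : ℝ → ℝ, ContDiff ℝ ∞ φ → HasCompactSupport φ → tsupport φ ⊆ Ioi a →
      ∫ x, V x * deriv φ x = 0) :
    ∃ c : ℝ, ∀ᵐ x, x ∈ Ioi a → V x = c := by
  -- The bump is supported in `[a + 1, a + 3]`, hence inside `(a, ∞)`.
  let B : ContDiffBump (a + 2 : ℝ) := ⟨1 / 2, 1, by norm_num, by norm_num⟩
  let χ : ℝ → ℝ := B.normed volume
  have hχ : ContDiff ℝ ∞ χ := B.contDiff_normed
  have hχc : HasCompactSupport χ := B.hasCompactSupport_normed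
  have hχt : tsupport χ ⊆ Ioi a := by
    rw [B.tsupport_normed_eq]
    intro x hx
    rw [Real.closedBall_eq_Icc] at hx
    have h1 := hx.1
    change a + 2 - 1 ≤ x at h1
    rw [mem_Ioi]; linarith
  have hχi : ∫ x, χ x = 1 := B.integral_normed
  refine ⟨∫ x, V x * χ x, ?_⟩
  have key : ∀ φ : ℝ → ℝ, ContDiff ℝ ∞ φ → HasCompactSupport φ → tsupport φ ⊆ Ioi a →
      ∫ x, φ x • (V x - ∫ x, V x * χ x) = 0 := by
    intro φ hφ hφc hφt
    have hVφ : Integrable fun x => V x * φ x := by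
      simpa [mul_comm] using hV.integrable_smul_left_of_hasCompactSupport hφ.continuous hφc
    have hVχ : Integrable fun x => V x * χ x := by
      simpa [mul_comm] using hV.integrable_smul_left_of_hasCompactSupport hχ.continuous hχc
    have hφi : Integrable φ := hφ.continuous.integrable_of_hasCompactSupport hφc
    have hχint : Integrable χ := hχ.continuous.integrable_of_hasCompactSupport hχc
    -- Subtracting a multiple of `χ` makes the integral zero, so that `φ₁` is the derivative of a
    -- test function.
    let φ₁ : ℝ → ℝ := fun x => φ x - (∫ x, φ x) * χ x
    have hφ₁ : ContDiff ℝ ∞ φ₁ := hφ.sub (contDiff_const.mul hχ)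
    have hφ₁i : ∫ x, φ₁ x = 0 := by
      simp only [φ₁]
      rw [integral_sub hφi (hχint.const_mul _), integral_const_mul, hχi]; ring
    obtain ⟨α, β, hαa, hsupp⟩ : ∃ α β : ℝ, a < α ∧ ∀ x, x ∉ Icc α β → φ₁ x = 0 := by
      have hK : IsCompact (tsupport φ ∪ tsupport χ) := hφc.isCompact.union hχc.isCompact
      have hKa : tsupport φ ∪ tsupport χ ⊆ Ioi a := union_subset hφt hχt
      have hne : (tsupport φ ∪ tsupport χ).Nonempty := by
        refine Nonempty.inr ?_
        rw [B.tsupport_normed_eq]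
        exact ⟨_, Metric.mem_closedBall_self B.rOut_pos.le⟩
      obtain ⟨α, hα, hα'⟩ := hK.exists_isLeast hne
      obtain ⟨β, -, hβ'⟩ := hK.exists_isGreatest hne
      refine ⟨α, β, hKa hα, fun x hx => ?_⟩
      have hx' : x ∉ tsupport φ ∪ tsupport χ := fun hx' =>
        hx ⟨hα' hx', hβ' hx'⟩
      rw [mem_union, not_or] at hx'
      simp only [φ₁]
      rw [image_eq_zero_of_notMem_tsupport hx'.1, image_eq_zero_of_notMem_tsupport hx'.2]
      simp
    have hc₁ : Continuous φ₁ := hφ₁.continuous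
    let Ψ : ℝ → ℝ := fun x => ∫ t in α..x, φ₁ t
    have hΨ' : ∀ x, HasDerivAt Ψ (φ₁ x) x := fun x =>
      intervalIntegral.integral_hasDerivAt_right (hc₁.intervalIntegrable _ _)
        (hc₁.stronglyMeasurableAtFilter _ _) hc₁.continuousAt
    have hdΨ : deriv Ψ = φ₁ := funext fun x => (hΨ' x).deriv
    have hΨs : ∀ x, x ∉ Icc α β → Ψ x = 0 := by
      intro x hx
      rcases lt_or_ge x α with hxα | hxα
      · refine intervalIntegral.integral_zero_ae (Filter.Eventually.of_forall fun t ht => ?_)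
        rw [uIoc_of_ge hxα.le] at ht
        -- At the endpoint `α` itself the vanishing of `φ₁` comes from continuity.
        rcases eq_or_lt_of_le ht.2 with rfl | ht2
        · by_contra hne
          have hcl : t ∈ closure (Iio t) := by simp
          have : ∀ y ∈ Iio t, φ₁ y = 0 := fun y hy => hsupp y fun hy' => not_lt.2 hy'.1 hy
          exact hne (((isClosed_singleton (x := (0 : ℝ))).preimage hc₁).closure_subset_iff.2
            (fun y hy => this y hy) hcl)
        · exact hsupp t fun h' => not_lt.2 h'.1 ht2
      · have hxβ : β < x := by
          by_contra hxβ
          exact hx ⟨hxα, not_lt.1 hxβ⟩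
        -- To the right of the support the primitive equals the full integral, which is zero.
        have : ∫ t in α..x, φ₁ t = ∫ t, φ₁ t := by
          rw [intervalIntegral.integral_of_le hxα, ← integral_Icc_eq_integral_Ioc,
            setIntegral_eq_integral_of_forall_compl_eq_zero]
          exact fun t ht => hsupp t fun h' => ht ⟨h'.1, h'.2.trans hxβ.le⟩
        exact this.trans hφ₁i
    have hts : tsupport Ψ ⊆ Icc α β := by
      refine closure_minimal (fun t ht => ?_) isClosed_Icc
      by_contra h'
      exact ht (hΨs t h')
    have hΨc : HasCompactSupport Ψ := HasCompactSupport.of_support_subset_isCompact isCompact_Icc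
      ((subset_tsupport _).trans hts)
    have hΨd : ContDiff ℝ ∞ Ψ := by
      rw [contDiff_infty_iff_deriv]
      exact ⟨fun x => (hΨ' x).differentiableAt, hdΨ ▸ hφ₁⟩
    have h0 := h Ψ hΨd hΨc (hts.trans fun x hx => hαa.trans_le hx.1)
    rw [hdΨ] at h0
    have e1 : ∫ x, V x * φ₁ x = (∫ x, V x * φ x) - (∫ x, φ x) * ∫ x, V x * χ x := by
      rw [← integral_const_mul, ← integral_sub hVφ (hVχ.const_mul _)]
      congr 1; ext x; simp only [φ₁]; ring
    have e2 : ∫ x, φ x • (V x - ∫ x, V x * χ x) =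
        (∫ x, V x * φ x) - (∫ x, φ x) * ∫ x, V x * χ x := by
      rw [← integral_mul_const, ← integral_sub hVφ (hφi.mul_const _)]
      congr 1; ext x; rw [smul_eq_mul]; ring
    rw [e2, ← e1, h0]
  have := isOpen_Ioi.ae_eq_zero_of_integral_contDiff_smul_eq_zero (U := Ioi a) (μ := volume)
    (f := fun x => V x - ∫ x, V x * χ x)
    ((hV.sub (locallyIntegrable_const _)).locallyIntegrableOn _) key
  filter_upwards [this] with x hx hxa
  exact sub_eq_zero.1 (hx hxa)

theorem intervalIntegrable_of_locallyIntegrable {f : ℝ → ℝ} (hf : LocallyIntegrable f volume)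
    (a b : ℝ) : IntervalIntegrable f volume a b :=
  (hf.integrableOn_isCompact isCompact_uIcc).intervalIntegrable

/-- Integration by parts for absolutely continuous functions on `[a, b]`, with `b` beyond the
support of `φ`: the boundary terms vanish, and the primitive has derivative `g` almost everywhere.
-/
theorem integral_primitive_mul_deriv {g φ : ℝ → ℝ} {a : ℝ} (hg : LocallyIntegrable g volume)
    (hφ : ContDiff ℝ ∞ φ) (hφc : HasCompactSupport φ) (hφa : tsupport φ ⊆ Ioi a) :
    ∫ x, (∫ t in a..x, g t) * deriv φ x = -∫ x, g x * φ x := by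
  obtain ⟨b, hab, hb⟩ : ∃ b, a < b ∧ tsupport φ ⊆ Ioo a b := by
    obtain ⟨b, hb⟩ := hφc.isCompact.bddAbove
    exact ⟨max b a + 1, by linarith [le_max_right b a], fun x hx => ⟨hφa hx, by
      linarith [hb hx, le_max_left b a]⟩⟩
  have hi : IntervalIntegrable g volume a b := intervalIntegrable_of_locallyIntegrable hg a b
  have hac := hi.absolutelyContinuousOnInterval_intervalIntegral (c := a) (by simp)
  have hφac : AbsolutelyContinuousOnInterval φ a b :=
    (hφ.of_le (by simp) : ContDiff ℝ 1 φ).contDiffOn.absolutelyContinuousOnInterval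
  have ibp := hac.integral_mul_deriv_eq_deriv_mul hφac
  have hz : ∀ x, x ∉ Ioo a b → φ x = 0 := fun x hx =>
    image_eq_zero_of_notMem_tsupport fun h' => hx (hb h')
  have s1 : Function.support (fun x => (∫ t in a..x, g t) * deriv φ x) ⊆ Ioc a b := by
    intro x hx
    have : deriv φ x ≠ 0 := right_ne_zero_of_mul hx
    exact Ioo_subset_Ioc_self (hb (support_deriv_subset this))
  have s2 : Function.support (fun x => g x * φ x) ⊆ Ioc a b := by
    intro x hx
    exact Ioo_subset_Ioc_self (hb (subset_tsupport _ (right_ne_zero_of_mul hx)))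
  rw [← intervalIntegral.integral_eq_integral_of_support_subset s1,
    ← intervalIntegral.integral_eq_integral_of_support_subset s2, ibp, hz a (by simp),
    hz b (by simp)]
  simp only [mul_zero, sub_zero, zero_sub, neg_inj]
  refine intervalIntegral.integral_congr_ae ?_
  filter_upwards [hi.ae_hasDerivAt_integral] with x hx hx'
  rw [(hx (uIoc_subset_uIcc hx') a (by simp)).deriv]

/-- A function of class `W^{1,2}` on a half-line has a bounded continuous representative. -/
theorem exists_continuous_bounded_representative_Ioi {v g : ℝ → ℝ} {a : ℝ}
    (hv : MemLp v 2 (volume.restrict (Ioi a))) (hg : MemLp g 2 (volume.restrict (Ioi a)))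
    (h : ∀ φ : ℝ → ℝ, ContDiff ℝ ∞ φ → HasCompactSupport φ → tsupport φ ⊆ Ioi a →
      ∫ x in Ioi a, v x * deriv φ x = -∫ x in Ioi a, g x * φ x) :
    ∃ w : ℝ → ℝ, Continuous w ∧ (∀ᵐ x, x ∈ Ioi a → v x = w x) ∧
      ∃ C, ∀ x ∈ Ici a, |w x| ≤ C := by
  let v₀ := (Ioi a).indicator v
  let g₀ := (Ioi a).indicator g
  have hv₀ : MemLp v₀ 2 volume := (memLp_indicator_iff_restrict measurableSet_Ioi).2 hv
  have hg₀ : MemLp g₀ 2 volume := (memLp_indicator_iff_restrict measurableSet_Ioi).2 hg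
  have hvl : LocallyIntegrable v₀ volume := hv₀.locallyIntegrable (by norm_num)
  have hgl : LocallyIntegrable g₀ volume := hg₀.locallyIntegrable (by norm_num)
  let G : ℝ → ℝ := fun x => ∫ t in a..x, g₀ t
  have hgi : ∀ x y, IntervalIntegrable g₀ volume x y :=
    intervalIntegrable_of_locallyIntegrable hgl
  have hG : Continuous G := intervalIntegral.continuous_primitive hgi a
  have hVl : LocallyIntegrable (fun x => v₀ x - G x) volume := hvl.sub hG.locallyIntegrable
  -- `v₀ - G` has zero weak derivative on `(a, ∞)`, because `G` is a primitive of `g₀`.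
  obtain ⟨c, hc⟩ := exists_ae_eq_const_of_integral_mul_deriv_eq_zero (a := a) hVl (by
    intro φ hφ hφc hφa
    have hφ' : Continuous (deriv φ) := hφ.continuous_deriv (by simp)
    have i1 : Integrable fun x => v₀ x * deriv φ x := by
      simpa [mul_comm] using hvl.integrable_smul_left_of_hasCompactSupport hφ' hφc.deriv
    have i2 : Integrable fun x => G x * deriv φ x := by
      simpa [mul_comm] using
        hG.locallyIntegrable.integrable_smul_left_of_hasCompactSupport hφ' hφc.deriv
    simp_rw [sub_mul]
    rw [integral_sub i1 i2, integral_primitive_mul_deriv hgl hφ hφc hφa]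
    have e1 : ∫ x, v₀ x * deriv φ x = ∫ x in Ioi a, v x * deriv φ x := by
      rw [← integral_indicator measurableSet_Ioi]
      congr 1; ext x; by_cases hx : x ∈ Ioi a <;> simp [v₀, indicator, hx]
    have e2 : ∫ x, g₀ x * φ x = ∫ x in Ioi a, g x * φ x := by
      rw [← integral_indicator measurableSet_Ioi]
      congr 1; ext x; by_cases hx : x ∈ Ioi a <;> simp [g₀, indicator, hx]
    rw [e1, e2, h φ hφ hφc hφa]; ring)
  have hw : Continuous fun x => G x + c := hG.add continuous_const
  have hvw : ∀ᵐ x, x ∈ Ioi a → v₀ x = G x + c := by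
    filter_upwards [hc] with x hx hxa
    linarith [hx hxa]
  refine ⟨fun x => G x + c, hw, ?_, ?_⟩
  · filter_upwards [hvw] with x hx hxa
    simpa [v₀, indicator, hxa] using hx hxa
  -- From `|f| ≤ 1 + f²`: an `L¹` bound on unit intervals, uniform in their position.
  have habs : ∀ f : ℝ → ℝ, MemLp f 2 volume → ∀ x : ℝ,
      ∫ t in x..x + 1, |f t| ≤ 1 + ∫ t, f t ^ 2 := by
    intro f hf x
    have hs : Integrable fun t => f t ^ 2 := hf.integrable_sq
    have hl : IntervalIntegrable f volume x (x + 1) :=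
      intervalIntegrable_of_locallyIntegrable (hf.locallyIntegrable (by norm_num)) _ _
    calc ∫ t in x..x + 1, |f t| ≤ ∫ t in x..x + 1, (1 + f t ^ 2) := by
          refine intervalIntegral.integral_mono_on (by linarith) hl.abs
            (intervalIntegrable_const.add hs.intervalIntegrable) fun t _ => ?_
          nlinarith [sq_abs (f t), sq_nonneg (|f t| - 1)]
      _ = 1 + ∫ t in x..x + 1, f t ^ 2 := by
          rw [intervalIntegral.integral_add intervalIntegrable_const hs.intervalIntegrable]
          simp
      _ ≤ 1 + ∫ t, f t ^ 2 := by
          rw [intervalIntegral.integral_of_le (by linarith)]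
          have := setIntegral_le_integral (s := Ioc x (x + 1)) hs
            (Filter.Eventually.of_forall fun t => sq_nonneg (f t))
          linarith
  refine ⟨(1 + ∫ t, v₀ t ^ 2) + (1 + ∫ t, g₀ t ^ 2), fun x hx => ?_⟩
  -- The value at `x` is compared with the value at every `y` in the next unit interval, then
  -- averaged over `y`; this bounds it by local `L¹` norms.
  have h1 : ∀ y ∈ Icc x (x + 1), |G x + c| ≤ |G y + c| + ∫ t in x..x + 1, |g₀ t| := by
    intro y hy
    have e : G y - G x = ∫ t in x..y, g₀ t :=
      intervalIntegral.integral_interval_sub_left (hgi _ _) (hgi _ _)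
    have b1 : |∫ t in x..y, g₀ t| ≤ ∫ t in x..y, |g₀ t| :=
      intervalIntegral.abs_integral_le_integral_abs hy.1
    have b2 : ∫ t in x..y, |g₀ t| ≤ ∫ t in x..x + 1, |g₀ t| :=
      intervalIntegral.integral_mono_interval le_rfl hy.1 hy.2
        (Filter.Eventually.of_forall fun t => abs_nonneg _) (hgi _ _).abs
    have b3 : |G x + c| ≤ |G y + c| + |G y - G x| := by
      have := abs_sub (G y + c) (G y - G x)
      rwa [show G y + c - (G y - G x) = G x + c by ring] at this
    rw [e] at b3
    linarith
  have h2 : |G x + c| ≤ ∫ y in x..x + 1, (|G y + c| + ∫ t in x..x + 1, |g₀ t|) := by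
    have := intervalIntegral.integral_mono_on (a := x) (b := x + 1) (μ := volume)
      (f := fun _ => |G x + c|) (by linarith) intervalIntegrable_const
      ((hw.abs.add continuous_const).intervalIntegrable _ _) h1
    simpa using this
  rw [intervalIntegral.integral_add (hw.abs.intervalIntegrable _ _) intervalIntegrable_const] at h2
  have h3 : ∫ y in x..x + 1, |G y + c| = ∫ y in x..x + 1, |v₀ y| := by
    refine intervalIntegral.integral_congr_ae ?_
    filter_upwards [hvw] with y hy hy'
    rw [uIoc_of_le (by linarith)] at hy'
    rw [hy (lt_of_le_of_lt hx hy'.1)]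
  simp only [intervalIntegral.integral_const, add_sub_cancel_left, smul_eq_mul, one_mul] at h2
  rw [h3] at h2
  linarith [habs v₀ hv₀ x, habs g₀ hg₀ x]

/-! ### The free surface and the continuous representative on it -/

theorem mem_freeSurface {x : ℝ} : x ∈ freeSurface ↔ 1 < |x| := Iff.rfl

theorem isOpen_freeSurface : IsOpen freeSurface := isOpen_lt continuous_const continuous_abs

theorem closure_freeSurface : closure freeSurface = {x | 1 ≤ |x|} := by
  refine subset_antisymm (closure_minimal (fun x hx => mem_ofPred_eq ▸ (mem_freeSurface.1 hx).le)
    (isClosed_le continuous_const continuous_abs)) fun x hx => ?_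
  rw [mem_ofPred_eq] at hx
  rcases le_abs'.1 hx with h | h
  · have : x ∈ closure (Iio (-1 : ℝ)) := by simpa using h
    exact closure_mono (fun y hy => mem_freeSurface.2
      (lt_abs.2 (Or.inr (by rw [mem_Iio] at hy; linarith)))) this
  · have : x ∈ closure (Ioi (1 : ℝ)) := by simpa using h
    exact closure_mono (fun y hy => mem_freeSurface.2 (lt_abs.2 (Or.inl hy))) this

theorem measurePreserving_neg_freeSurface :
    MeasurePreserving (fun x : ℝ => -x) (volume.restrict freeSurface)
      (volume.restrict freeSurface) := by
  have h := (Measure.measurePreserving_neg (volume : Measure ℝ)).restrict_preimage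
    isOpen_freeSurface.measurableSet
  have e : Neg.neg ⁻¹' freeSurface = freeSurface := by ext x; simp [freeSurface]
  rwa [e] at h

theorem setIntegral_freeSurface_comp_neg (f : ℝ → ℝ) :
    ∫ x in freeSurface, f (-x) = ∫ x in freeSurface, f x :=
  measurePreserving_neg_freeSurface.integral_comp (MeasurableEquiv.neg ℝ).measurableEmbedding f

/-- The reflection reduces the component `x < -1` to the half-line `x > 1`. -/
theorem MemW12.comp_neg {v : ℝ → ℝ} (hv : MemW12 freeSurface v) :
    MemW12 freeSurface fun x => v (-x) := by
  obtain ⟨hv2, g, hg, h⟩ := hv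
  refine ⟨hv2.comp_measurePreserving measurePreserving_neg_freeSurface, fun x => -g (-x),
    (hg.comp_measurePreserving measurePreserving_neg_freeSurface).neg, fun φ hφ hφc hφt => ?_⟩
  have hd : ∀ x, deriv (fun y => φ (-y)) x = -deriv φ (-x) := fun x => deriv_comp_neg φ x
  have := h (fun x => φ (-x)) (hφ.comp contDiff_neg)
    (hφc.comp_homeomorph (Homeomorph.neg ℝ)) (by
      intro x hx
      have hx' : -x ∈ tsupport φ := by
        have := tsupport_comp_eq_preimage φ (Homeomorph.neg ℝ)
        have hx2 : x ∈ tsupport (φ ∘ (Homeomorph.neg ℝ)) := hx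
        rw [this] at hx2
        exact hx2
      have := hφt hx'
      simpa [freeSurface] using this)
  simp_rw [hd] at this
  rw [← setIntegral_freeSurface_comp_neg (fun x => v x * -deriv φ (-x)),
    ← setIntegral_freeSurface_comp_neg (fun x => g x * φ (-x))] at this
  simp only [neg_neg, mul_neg, integral_neg, neg_mul] at this ⊢
  linarith

theorem Ioi_one_subset_freeSurface : Ioi (1 : ℝ) ⊆ freeSurface := fun _ hx =>
  mem_freeSurface.2 (lt_abs.2 (Or.inl hx))

theorem MemW12.exists_representative_Ioi {v : ℝ → ℝ} (hv : MemW12 freeSurface v) :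
    ∃ w : ℝ → ℝ, Continuous w ∧ (∀ᵐ x, x ∈ Ioi (1 : ℝ) → v x = w x) ∧
      ∃ C, ∀ x ∈ Ici (1 : ℝ), |w x| ≤ C := by
  obtain ⟨hv2, g, hg, h⟩ := hv
  have hμ := Measure.restrict_mono_set (volume : Measure ℝ) Ioi_one_subset_freeSurface
  refine exists_continuous_bounded_representative_Ioi (hv2.mono_measure hμ) (hg.mono_measure hμ) ?_
  intro φ hφ hφc hφt
  rw [← setIntegral_eq_of_subset_of_forall_sdiff_eq_zero isOpen_freeSurface.measurableSet
      Ioi_one_subset_freeSurface,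
    ← setIntegral_eq_of_subset_of_forall_sdiff_eq_zero isOpen_freeSurface.measurableSet
      Ioi_one_subset_freeSurface, h φ hφ hφc (hφt.trans Ioi_one_subset_freeSurface)]
  · intro x hx
    rw [image_eq_zero_of_notMem_tsupport fun h' => hx.2 (hφt h'), mul_zero]
  · intro x hx
    have : deriv φ x = 0 := by
      by_contra h'
      exact hx.2 (hφt (support_deriv_subset h'))
    rw [this, mul_zero]

/-- A function of class `W^{1,2}` on the free surface has a representative that is continuous and
bounded on the closed free surface. -/
theorem MemW12.exists_representative {v : ℝ → ℝ} (hv : MemW12 freeSurface v) :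
    ∃ w : ℝ → ℝ, ContinuousOn w (closure freeSurface) ∧
      v =ᵐ[volume.restrict freeSurface] w ∧ ∃ C, ∀ x, 1 ≤ |x| → |w x| ≤ C := by
  obtain ⟨w₁, hw₁, hvw₁, C₁, hC₁⟩ := hv.exists_representative_Ioi
  obtain ⟨w₂, hw₂, hvw₂, C₂, hC₂⟩ := hv.comp_neg.exists_representative_Ioi
  refine ⟨fun x => if 0 < x then w₁ x else w₂ (-x), ?_, ?_, max C₁ C₂, ?_⟩
  · rw [closure_freeSurface]
    intro x hx
    refine ContinuousAt.continuousWithinAt ?_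
    rcases lt_trichotomy x 0 with h | h | h
    · refine (hw₂.comp continuous_neg).continuousAt.congr ?_
      filter_upwards [Iio_mem_nhds h] with y hy
      rw [if_neg (not_lt.2 (le_of_lt hy))]; rfl
    · subst h; simp at hx; linarith
    · refine hw₁.continuousAt.congr ?_
      filter_upwards [Ioi_mem_nhds h] with y hy
      exact (if_pos (mem_Ioi.1 hy)).symm
  · rw [Filter.EventuallyEq, ae_restrict_iff' isOpen_freeSurface.measurableSet]
    have h2 := (Measure.measurePreserving_neg (volume : Measure ℝ)).quasiMeasurePreserving.ae hvw₂
    filter_upwards [hvw₁, h2] with x hx₁ hx₂ hx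
    rcases lt_abs.1 (mem_freeSurface.1 hx) with h | h
    · rw [if_pos (by linarith)]; exact hx₁ h
    · rw [if_neg (by linarith)]; simpa using hx₂ h
  · intro x hx
    beta_reduce
    rcases le_abs.1 hx with h | h
    · rw [if_pos (by linarith)]; exact (hC₁ x h).trans (le_max_left _ _)
    · rw [if_neg (by linarith)]; exact (hC₂ (-x) h).trans (le_max_right _ _)

/-! ### The symmetric extension of the boundary datum -/

theorem symmExtension_of_one_le {w : ℝ → ℝ} {x : ℝ} (hx : 1 ≤ |x|) : symmExtension w x = w x :=
  if_pos hx

theorem symmExtension_of_abs_le_one {w : ℝ → ℝ} {x : ℝ} (hx : |x| ≤ 1) (h0 : x ≠ 0) :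
    symmExtension w x = w (1 / x) := by
  rcases hx.eq_or_lt with h | h
  · rw [symmExtension_of_one_le h.ge]
    rcases eq_or_eq_neg_of_abs_eq h with rfl | rfl <;> norm_num
  · rw [symmExtension, if_neg (not_le.2 h), if_neg h0]

theorem one_le_abs_one_div {x : ℝ} (hx : |x| ≤ 1) (h0 : x ≠ 0) : 1 ≤ |1 / x| := by
  rw [abs_div, abs_one]
  exact one_le_one_div (abs_pos.2 h0) hx

theorem abs_symmExtension_le {w : ℝ → ℝ} {C : ℝ} (hC : ∀ x, 1 ≤ |x| → |w x| ≤ C) (x : ℝ) :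
    |symmExtension w x| ≤ C := by
  rcases le_total 1 |x| with h | h
  · rw [symmExtension_of_one_le h]; exact hC x h
  · by_cases h0 : x = 0
    · have : symmExtension w x = 0 := by simp [symmExtension, h0]
      rw [this, abs_zero]
      exact (abs_nonneg _).trans (hC 1 (by simp))
    · rw [symmExtension_of_abs_le_one h h0]
      exact hC _ (one_le_abs_one_div h h0)

/-- The line is covered by the closed sets `|x| ≥ 1` and `|x| ≤ 1`. The two formulas agree where
they meet, since `1 / x = x` for `x = ±1`. -/
theorem continuousAt_symmExtension {w : ℝ → ℝ} (hw : ContinuousOn w (closure freeSurface)) {x : ℝ}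
    (hx : x ≠ 0) : ContinuousAt (symmExtension w) x := by
  rw [closure_freeSurface] at hw
  have hA : IsClosed {x : ℝ | 1 ≤ |x|} := isClosed_le continuous_const continuous_abs
  have hB : IsClosed {x : ℝ | |x| ≤ 1} := isClosed_le continuous_abs continuous_const
  have hU : {x : ℝ | 1 ≤ |x|} ∪ {x : ℝ | |x| ≤ 1} = univ :=
    eq_univ_of_forall fun y => le_total 1 |y|
  rw [← continuousWithinAt_univ, ← hU]
  refine ContinuousWithinAt.union ?_ ?_
  · by_cases hxA : 1 ≤ |x|
    · exact (hw x hxA).congr (fun y hy => symmExtension_of_one_le hy) (symmExtension_of_one_le hxA)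
    · exact continuousWithinAt_of_notMem_closure (by rw [hA.closure_eq]; exact hxA)
  · by_cases hxB : |x| ≤ 1
    · have h1 : ContinuousWithinAt (fun y => w (1 / y)) ({x : ℝ | |x| ≤ 1} ∩ {0}ᶜ) x := by
        refine ContinuousWithinAt.comp (t := {x : ℝ | 1 ≤ |x|})
          (hw (1 / x) (one_le_abs_one_div hxB hx)) ?_ ?_
        · exact (continuousAt_const.div continuousAt_id hx).continuousWithinAt
        · exact fun y hy => one_le_abs_one_div hy.1 hy.2
      have h2 : ContinuousWithinAt (symmExtension w) ({x : ℝ | |x| ≤ 1} ∩ {0}ᶜ) x :=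
        h1.congr (fun y hy => symmExtension_of_abs_le_one hy.1 hy.2)
          (symmExtension_of_abs_le_one hxB hx)
      exact (continuousWithinAt_inter (isOpen_compl_singleton.mem_nhds hx)).1 h2
    · exact continuousWithinAt_of_notMem_closure (by rw [hB.closure_eq]; exact hxB)

theorem measurable_symmExtension {w : ℝ → ℝ} (hw : ContinuousOn w (closure freeSurface)) :
    Measurable (symmExtension w) :=
  measurable_of_continuousOn_compl_singleton 0 fun _ hx =>
    (continuousAt_symmExtension hw hx).continuousWithinAt

/-! ### The Poisson extension to the half-plane -/

/-- The scale-invariant form of the Poisson extension, valid up to the boundary. -/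
theorem dirichletHalfPlane_eq (η : ℝ → ℝ) {z : ℂ} (hz : 0 ≤ z.im) :
    dirichletHalfPlane η z = (Real.pi)⁻¹ * ∫ τ : ℝ, (1 + τ ^ 2)⁻¹ * η (z.re + z.im * τ) := by
  rcases hz.eq_or_lt with h | h
  · rw [dirichletHalfPlane, if_neg (by rw [← h]; exact lt_irrefl _), ← h]
    simp only [zero_mul, add_zero]
    rw [integral_mul_const, integral_univ_inv_one_add_sq, ← mul_assoc,
      inv_mul_cancel₀ Real.pi_ne_zero, one_mul]
  · rw [dirichletHalfPlane, if_pos h]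
    set f : ℝ → ℝ := fun t => z.im / (Real.pi * ((z.re - t) ^ 2 + z.im ^ 2)) * η t with hf
    -- The substitution `t = x + y τ`.
    have e : ∫ t, f t = z.im * ∫ τ, f (z.re + z.im * τ) := by
      rw [Measure.integral_comp_mul_left (fun t => f (z.re + t)) z.im, integral_add_left_eq_self f,
        smul_eq_mul, abs_of_pos (inv_pos.2 h), ← mul_assoc, mul_inv_cancel₀ h.ne', one_mul]
    rw [e, ← integral_const_mul, ← integral_const_mul]
    congr 1
    ext τ
    have h1 : (1 + τ ^ 2) ≠ 0 := by positivity
    have h2 : (z.re - (z.re + z.im * τ)) ^ 2 + z.im ^ 2 = z.im ^ 2 * (1 + τ ^ 2) := by ring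
    simp only [hf]
    rw [h2]
    have := Real.pi_ne_zero
    have := h.ne'
    field_simp

/-- The Poisson kernel is nonnegative with total mass one. -/
theorem abs_dirichletHalfPlane_le {η : ℝ → ℝ} {C : ℝ} (hC : ∀ x, |η x| ≤ C) {z : ℂ}
    (hz : 0 ≤ z.im) : |dirichletHalfPlane η z| ≤ C := by
  rw [dirichletHalfPlane_eq η hz, abs_mul, abs_of_pos (inv_pos.2 Real.pi_pos)]
  have h : |∫ τ : ℝ, (1 + τ ^ 2)⁻¹ * η (z.re + z.im * τ)| ≤ ∫ τ : ℝ, (1 + τ ^ 2)⁻¹ * C := by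
    rw [← Real.norm_eq_abs]
    refine norm_integral_le_of_norm_le (integrable_inv_one_add_sq.mul_const C)
      (Filter.Eventually.of_forall fun τ => ?_)
    have : 0 ≤ (1 + τ ^ 2)⁻¹ := by positivity
    rw [norm_mul, Real.norm_of_nonneg this]
    exact mul_le_mul_of_nonneg_left (hC _) this
  rw [integral_mul_const, integral_univ_inv_one_add_sq] at h
  calc _ ≤ (Real.pi)⁻¹ * (Real.pi * C) :=
        mul_le_mul_of_nonneg_left h (inv_nonneg.2 Real.pi_pos.le)
    _ = C := by rw [← mul_assoc, inv_mul_cancel₀ Real.pi_ne_zero, one_mul]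

/-- Dominated convergence in the scale-invariant form, which treats interior and boundary points
alike. For `z ≠ 0` the argument `x + y τ` meets the bad point `0` for at most one `τ`. -/
theorem continuousWithinAt_dirichletHalfPlane {η : ℝ → ℝ} {C : ℝ} (hm : Measurable η)
    (hC : ∀ x, |η x| ≤ C) (hη : ∀ x, x ≠ 0 → ContinuousAt η x) {z : ℂ} (hz : 0 ≤ z.im)
    (h0 : z ≠ 0) : ContinuousWithinAt (dirichletHalfPlane η) {z | 0 ≤ z.im} z := by
  have hc : ContinuousAt
      (fun z : ℂ => (Real.pi)⁻¹ * ∫ τ : ℝ, (1 + τ ^ 2)⁻¹ * η (z.re + z.im * τ)) z := by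
    refine continuousAt_const.mul ?_
    refine continuousAt_of_dominated (bound := fun τ => (1 + τ ^ 2)⁻¹ * C)
      (Filter.Eventually.of_forall fun z => ?_)
      (Filter.Eventually.of_forall fun z => Filter.Eventually.of_forall fun τ => ?_)
      (integrable_inv_one_add_sq.mul_const C) ?_
    · exact (Measurable.mul (by fun_prop) (hm.comp (by fun_prop))).aestronglyMeasurable
    · have : 0 ≤ (1 + τ ^ 2)⁻¹ := by positivity
      rw [norm_mul, Real.norm_of_nonneg this]
      exact mul_le_mul_of_nonneg_left (hC _) this
    · have hne : ∀ᵐ τ : ℝ, z.re + z.im * τ ≠ 0 := by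
        by_cases hi : z.im = 0
        · have hr : z.re ≠ 0 := fun hr => h0 (Complex.ext hr hi)
          simp [hi, hr]
        · have : {τ : ℝ | z.re + z.im * τ ≠ 0}ᶜ ⊆ {-z.re / z.im} := by
            intro τ hτ
            have hτ' : z.re + z.im * τ = 0 := by simpa using hτ
            rw [mem_singleton_iff, eq_div_iff hi]; linarith
          exact measure_mono_null this (by simp)
      filter_upwards [hne] with τ hτ
      refine continuousAt_const.mul (ContinuousAt.comp (f := fun z : ℂ => z.re + z.im * τ)
        (hη _ hτ) (by fun_prop))
  exact hc.continuousWithinAt.congr (fun y hy => dirichletHalfPlane_eq η hy)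
    (dirichletHalfPlane_eq η hz)

/-! ### Harmonicity of the Poisson extension -/

/-- Comparison of the kernel with `1 / (1 + t²)`, uniform for `z` in a set `y ≥ y₁`, `|x| ≤ X`; it
supplies the dominating functions below. -/
theorem one_add_sq_le_mul_sq_norm_sub {z : ℂ} {X y₁ : ℝ} (hy : 0 < y₁) (hzy : y₁ ≤ z.im)
    (hzX : |z.re| ≤ X) (t : ℝ) :
    1 + t ^ 2 ≤ (2 + (2 * X ^ 2 + 1) / y₁ ^ 2) * ‖(t : ℂ) - z‖ ^ 2 := by
  have hn : ‖(t : ℂ) - z‖ ^ 2 = (t - z.re) ^ 2 + z.im ^ 2 := by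
    rw [Complex.sq_norm, Complex.normSq_apply]; simp; ring
  have hX : z.re ^ 2 ≤ X ^ 2 := sq_le_sq' (abs_le.1 hzX).1 (abs_le.1 hzX).2
  have h1 : y₁ ^ 2 ≤ ‖(t : ℂ) - z‖ ^ 2 := by
    rw [hn]; nlinarith [sq_nonneg (t - z.re)]
  have h2 : 2 * X ^ 2 + 1 ≤ (2 * X ^ 2 + 1) / y₁ ^ 2 * ‖(t : ℂ) - z‖ ^ 2 := by
    rw [div_mul_eq_mul_div, le_div_iff₀ (by positivity)]
    exact mul_le_mul_of_nonneg_left h1 (by positivity)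
  have h3 : t ^ 2 ≤ 2 * (t - z.re) ^ 2 + 2 * z.re ^ 2 := by nlinarith [sq_nonneg (t - 2 * z.re)]
  have h4 : (t - z.re) ^ 2 ≤ ‖(t : ℂ) - z‖ ^ 2 := by rw [hn]; nlinarith [sq_nonneg z.im]
  rw [add_mul]
  linarith

theorem ofReal_sub_ne_zero {z : ℂ} (hz : 0 < z.im) (t : ℝ) : (t : ℂ) - z ≠ 0 := by
  intro h
  have := congrArg Complex.im h
  simp at this
  linarith

theorem inv_sq_norm_sub_le {z : ℂ} {X y₁ : ℝ} (hy : 0 < y₁) (hzy : y₁ ≤ z.im)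
    (hzX : |z.re| ≤ X) (t : ℝ) :
    (‖(t : ℂ) - z‖ ^ 2)⁻¹ ≤ (2 + (2 * X ^ 2 + 1) / y₁ ^ 2) * (1 + t ^ 2)⁻¹ := by
  have h := one_add_sq_le_mul_sq_norm_sub hy hzy hzX t
  have hp : 0 < ‖(t : ℂ) - z‖ ^ 2 := by
    have := norm_pos_iff.2 (ofReal_sub_ne_zero (hy.trans_le hzy) t)
    positivity
  rw [← div_eq_mul_inv, le_div_iff₀ (by positivity), inv_mul_le_iff₀ hp]
  linarith

theorem continuous_inv_ofReal_sub {z : ℂ} (hz : 0 < z.im) :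
    Continuous fun t : ℝ => ((t : ℂ) - z)⁻¹ :=
  (Complex.continuous_ofReal.sub continuous_const).inv₀ (ofReal_sub_ne_zero hz)

theorem integrable_inv_sq_norm_sub {z : ℂ} (hz : 0 < z.im) :
    Integrable fun t : ℝ => (‖(t : ℂ) - z‖ ^ 2)⁻¹ := by
  refine Integrable.mono' (integrable_inv_one_add_sq.const_mul
    (2 + (2 * |z.re| ^ 2 + 1) / z.im ^ 2)) ?_ (Filter.Eventually.of_forall fun t => ?_)
  · refine Continuous.aestronglyMeasurable ?_
    simp_rw [← inv_pow, ← norm_inv]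
    exact (continuous_inv_ofReal_sub hz).norm.pow 2
  · rw [Real.norm_of_nonneg (by positivity)]
    exact inv_sq_norm_sub_le hz le_rfl le_rfl t

theorem im_inv_ofReal_sub (z : ℂ) (t : ℝ) :
    (((t : ℂ) - z)⁻¹).im = z.im / ((z.re - t) ^ 2 + z.im ^ 2) := by
  rw [Complex.inv_im, Complex.normSq_apply]
  simp
  congr 1; ring

/-- A holomorphic function on the half-plane whose imaginary part is, up to an additive constant,
`π` times the Poisson extension of `η`. -/
noncomputable def poissonPotential (η : ℝ → ℝ) (z : ℂ) : ℂ :=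
  ∫ t : ℝ, (η t : ℂ) * (((t : ℂ) - z)⁻¹ - ((t : ℂ) - Complex.I)⁻¹)

/-- A single kernel decays only like `1 / |t|`, not enough for a merely bounded `η`. The difference
is `(z - i) / ((t - z) (t - i))`, which decays quadratically. -/
theorem integrable_poissonPotential {η : ℝ → ℝ} {C : ℝ} (hm : Measurable η)
    (hC : ∀ x, |η x| ≤ C) {z : ℂ} (hz : 0 < z.im) :
    Integrable fun t : ℝ => (η t : ℂ) * (((t : ℂ) - z)⁻¹ - ((t : ℂ) - Complex.I)⁻¹) := by
  have hI : 0 < Complex.I.im := by simp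
  refine Integrable.bdd_mul (c := C) ?_ (Complex.measurable_ofReal.comp hm).aestronglyMeasurable
    (Filter.Eventually.of_forall fun t => by simpa using hC t)
  refine Integrable.mono' (((integrable_inv_sq_norm_sub hz).add
    (integrable_inv_sq_norm_sub hI)).const_mul ‖z - Complex.I‖)
    ((continuous_inv_ofReal_sub hz).sub (continuous_inv_ofReal_sub hI)).aestronglyMeasurable
    (Filter.Eventually.of_forall fun t => ?_)
  have h1 := ofReal_sub_ne_zero hz t
  have h2 := ofReal_sub_ne_zero hI t
  rw [inv_sub_inv h1 h2, sub_sub_sub_cancel_left, norm_div, norm_mul, div_eq_mul_inv, mul_inv]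
  refine mul_le_mul_of_nonneg_left ?_ (norm_nonneg _)
  simp only [Pi.add_apply, ← inv_pow]
  nlinarith [sq_nonneg (‖(t : ℂ) - z‖⁻¹ - ‖(t : ℂ) - Complex.I‖⁻¹), sq_nonneg (‖(t : ℂ) - z‖⁻¹),
    sq_nonneg (‖(t : ℂ) - Complex.I‖⁻¹)]

theorem differentiableAt_poissonPotential {η : ℝ → ℝ} {C : ℝ} (hm : Measurable η)
    (hC : ∀ x, |η x| ≤ C) {z : ℂ} (hz : 0 < z.im) :
    DifferentiableAt ℂ (poissonPotential η) z := by
  have hI : 0 < Complex.I.im := by simp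
  have hη : AEStronglyMeasurable (fun t => (η t : ℂ)) volume :=
    (Complex.measurable_ofReal.comp hm).aestronglyMeasurable
  -- On the ball of radius `y / 2` the height stays at least `y / 2`, so one integrable bound serves
  -- all its points.
  have hball : ∀ x ∈ Metric.ball z (z.im / 2), z.im / 2 ≤ x.im ∧ |x.re| ≤ |z.re| + z.im / 2 := by
    intro x hx
    rw [Metric.mem_ball, dist_eq_norm] at hx
    have h1 := (Complex.abs_im_le_norm (x - z)).trans hx.le
    have h2 := (Complex.abs_re_le_norm (x - z)).trans hx.le
    rw [Complex.sub_im] at h1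
    rw [Complex.sub_re] at h2
    refine ⟨by linarith [(abs_le.1 h1).1], ?_⟩
    have := abs_add_le z.re (x.re - z.re)
    rw [add_sub_cancel] at this
    linarith
  have hpos : 0 < z.im / 2 := by linarith
  refine (hasDerivAt_integral_of_dominated_loc_of_deriv_le (𝕜 := ℂ) (μ := volume)
    (F := fun (z : ℂ) (t : ℝ) => (η t : ℂ) * (((t : ℂ) - z)⁻¹ - ((t : ℂ) - Complex.I)⁻¹))
    (F' := fun (z : ℂ) (t : ℝ) => (η t : ℂ) * (((t : ℂ) - z) ^ 2)⁻¹)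
    (bound := fun t => C * ((2 + (2 * (|z.re| + z.im / 2) ^ 2 + 1) / (z.im / 2) ^ 2) *
      (1 + t ^ 2)⁻¹))
    (Metric.ball_mem_nhds z hpos) ?_ (integrable_poissonPotential hm hC hz)
    ?_ ?_ ?_ ?_).2.differentiableAt
  · filter_upwards [Metric.ball_mem_nhds z hpos] with x hx
    exact (integrable_poissonPotential hm hC (hpos.trans_le (hball x hx).1)).aestronglyMeasurable
  · refine hη.mul (Continuous.aestronglyMeasurable ?_)
    simp_rw [← inv_pow]
    exact (continuous_inv_ofReal_sub hz).pow 2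
  · refine Filter.Eventually.of_forall fun t x hx => ?_
    rw [norm_mul, norm_inv, norm_pow]
    refine mul_le_mul (by simpa using hC t)
      (inv_sq_norm_sub_le hpos (hball x hx).1 (hball x hx).2 t) (by positivity)
      ((abs_nonneg _).trans (hC t))
  · exact (integrable_inv_one_add_sq.const_mul _).const_mul _
  · refine Filter.Eventually.of_forall fun t x hx => ?_
    have hx0 := ofReal_sub_ne_zero (hpos.trans_le (hball x hx).1) t
    have h1 : HasDerivAt (fun z : ℂ => (t : ℂ) - z) (-1) x := by
      simpa using (hasDerivAt_id x).const_sub (t : ℂ)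
    have h2 := ((h1.inv hx0).sub_const (((t : ℂ) - Complex.I)⁻¹)).const_mul (η t : ℂ)
    refine h2.congr_deriv ?_
    rw [neg_neg, one_div]

/-- The imaginary part of `1 / (t - z)` is `π` times the Poisson kernel; the term at `i` contributes
a constant. -/
theorem dirichletHalfPlane_eq_im {η : ℝ → ℝ} {C : ℝ} (hm : Measurable η)
    (hC : ∀ x, |η x| ≤ C) {z : ℂ} (hz : 0 < z.im) :
    dirichletHalfPlane η z = (Real.pi)⁻¹ * ((poissonPotential η z).im +
      ∫ t : ℝ, η t * (((t : ℂ) - Complex.I)⁻¹).im) := by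
  have hI : 0 < Complex.I.im := by simp
  have hint := integrable_poissonPotential hm hC hz
  have h1 : (poissonPotential η z).im =
      ∫ t : ℝ, η t * ((((t : ℂ) - z)⁻¹).im - (((t : ℂ) - Complex.I)⁻¹).im) := by
    rw [poissonPotential, ← Complex.imCLM_apply, ← ContinuousLinearMap.integral_comp_comm _ hint]
    congr 1; ext t; simp
  have i1 : Integrable fun t : ℝ =>
      η t * ((((t : ℂ) - z)⁻¹).im - (((t : ℂ) - Complex.I)⁻¹).im) := by
    refine hint.im.congr (Filter.Eventually.of_forall fun t => ?_)
    simp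
  have i2 : Integrable fun t : ℝ => η t * (((t : ℂ) - Complex.I)⁻¹).im := by
    refine Integrable.bdd_mul (c := C) ?_ hm.aestronglyMeasurable
      (Filter.Eventually.of_forall fun t => by simpa using hC t)
    refine integrable_inv_one_add_sq.congr (Filter.Eventually.of_forall fun t => ?_)
    simp only
    rw [im_inv_ofReal_sub]
    simp [add_comm]
  rw [h1, ← integral_add i1 i2, ← integral_const_mul, dirichletHalfPlane, if_pos hz]
  congr 1; ext t
  rw [im_inv_ofReal_sub, im_inv_ofReal_sub, ← mul_add, sub_add_cancel, div_mul_eq_div_div]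
  ring_nf

theorem harmonicOnNhd_dirichletHalfPlane {η : ℝ → ℝ} {C : ℝ} (hm : Measurable η)
    (hC : ∀ x, |η x| ≤ C) : HarmonicOnNhd (dirichletHalfPlane η) {z | 0 < z.im} := by
  intro z hz
  have hop : IsOpen {z : ℂ | 0 < z.im} := isOpen_lt continuous_const Complex.continuous_im
  have han : AnalyticAt ℂ (poissonPotential η) z :=
    DifferentiableOn.analyticAt (s := {z : ℂ | 0 < z.im})
      (fun x hx => (differentiableAt_poissonPotential hm hC hx).differentiableWithinAt)
      (hop.mem_nhds hz)
  have h1 := (han.harmonicAt_im.add (harmonicAt_const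
    (∫ t : ℝ, η t * (((t : ℂ) - Complex.I)⁻¹).im))).const_smul (c := (Real.pi)⁻¹)
  refine (harmonicAt_congr_nhds ?_).2 h1
  filter_upwards [hop.mem_nhds hz] with x hx
  exact dirichletHalfPlane_eq_im hm hC hx

/-! ### Folding the Poisson kernel by inversion -/

/-- The image is `0 < |t| < 1`, which misses only the points `0`, `1`, `-1` of the complement. -/
theorem image_one_div_freeSurface_ae_eq :
    (Set.image (fun s : ℝ => 1 / s) freeSurface : Set ℝ) =ᵐ[volume] freeSurfaceᶜ := by
  have h : Set.image (fun s : ℝ => 1 / s) freeSurface = freeSurfaceᶜ \ {0, 1, -1} := by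
    ext t
    simp only [mem_image, mem_sdiff, mem_compl_iff, mem_freeSurface, mem_insert_iff,
      mem_singleton_iff, not_or, not_lt]
    constructor
    · rintro ⟨s, hs, rfl⟩
      have h0 : s ≠ 0 := by rintro rfl; simp at hs; linarith
      have hlt : |1 / s| < 1 := by
        rw [abs_div, abs_one, div_lt_one (abs_pos.2 h0)]; exact hs
      refine ⟨hlt.le, one_div_ne_zero h0, ?_, ?_⟩
      · intro h; rw [h] at hlt; simp at hlt
      · intro h; rw [h] at hlt; simp at hlt
    · rintro ⟨ht, h0, h1, h2⟩
      refine ⟨1 / t, ?_, by simp⟩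
      have : |t| < 1 := lt_of_le_of_ne ht fun h => by
        rcases eq_or_eq_neg_of_abs_eq h with h | h
        · exact h1 h
        · exact h2 h
      rw [abs_div, abs_one]
      exact (one_lt_div (abs_pos.2 h0)).2 this
  rw [h]
  exact sdiff_null_ae_eq_self ((Set.toFinite _).measure_zero _)

theorem hasDerivAt_one_div {s : ℝ} (hs : s ≠ 0) :
    HasDerivAt (fun s : ℝ => 1 / s) (-(s ^ 2)⁻¹) s := by
  simpa [one_div] using hasDerivAt_inv hs

theorem ne_zero_of_mem_freeSurface {s : ℝ} (hs : s ∈ freeSurface) : s ≠ 0 := by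
  rintro rfl
  rw [mem_freeSurface, abs_zero] at hs
  linarith

theorem integrable_poissonKernel_mul {η : ℝ → ℝ} {C : ℝ} (hm : Measurable η)
    (hC : ∀ x, |η x| ≤ C) {z : ℂ} (hz : 0 < z.im) :
    Integrable fun t : ℝ => z.im / ((z.re - t) ^ 2 + z.im ^ 2) * η t := by
  refine Integrable.mul_bdd (c := C) ?_ hm.aestronglyMeasurable
    (Filter.Eventually.of_forall fun t => by simpa using hC t)
  refine ((integrable_inv_sq_norm_sub hz).const_mul z.im).congr
    (Filter.Eventually.of_forall fun t => ?_)
  have hn : ‖(t : ℂ) - z‖ ^ 2 = (z.re - t) ^ 2 + z.im ^ 2 := by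
    rw [Complex.sq_norm, Complex.normSq_apply]; simp; ring
  simp only [hn, div_eq_mul_inv]

/-- The kernel of the mixed problem is the Poisson kernel of the half-plane folded by the inversion
`t ↦ 1 / t`. -/
theorem dirichletOmega_eq_dirichletHalfPlane {w : ℝ → ℝ} {C : ℝ}
    (hw : ContinuousOn w (closure freeSurface)) (hC : ∀ x, 1 ≤ |x| → |w x| ≤ C) {z : ℂ}
    (hz : 0 < z.im) : dirichletOmega w z = dirichletHalfPlane (symmExtension w) z := by
  set η := symmExtension w with hη
  have hS : MeasurableSet freeSurface := isOpen_freeSurface.measurableSet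
  set f : ℝ → ℝ := fun t => z.im / ((z.re - t) ^ 2 + z.im ^ 2) * η t with hf
  have hfi : Integrable f :=
    integrable_poissonKernel_mul (measurable_symmExtension hw) (abs_symmExtension_le hC) hz
  have hd : ∀ s ∈ freeSurface, HasDerivWithinAt (fun s : ℝ => 1 / s) (-(s ^ 2)⁻¹) freeSurface s :=
    fun s hs => (hasDerivAt_one_div (ne_zero_of_mem_freeSurface hs)).hasDerivWithinAt
  have hinj : InjOn (fun s : ℝ => 1 / s) freeSurface := fun a _ b _ hab => by
    simpa [one_div] using hab
  have hcv := integral_image_eq_integral_abs_deriv_smul hS hd hinj f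
  have hcvi := (integrableOn_image_iff_integrableOn_abs_deriv_smul hS hd hinj f).1 hfi.integrableOn
  -- The Jacobian `1 / s²` cancels against the same factor in the transformed denominator.
  have e1 : ∀ s ∈ freeSurface, |-(s ^ 2)⁻¹| • f (1 / s) =
      z.im / ((z.re * s - 1) ^ 2 + z.im ^ 2 * s ^ 2) * w s := by
    intro s hs
    have h0 := ne_zero_of_mem_freeSurface hs
    have hle : |1 / s| ≤ 1 := by
      rw [abs_div, abs_one, div_le_one (abs_pos.2 h0)]; exact (mem_freeSurface.1 hs).le
    have hηs : η (1 / s) = w s := by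
      rw [hη, symmExtension_of_abs_le_one hle (one_div_ne_zero h0), one_div_one_div]
    have hk : (z.re - 1 / s) ^ 2 + z.im ^ 2 =
        ((z.re * s - 1) ^ 2 + z.im ^ 2 * s ^ 2) * (s ^ 2)⁻¹ := by field_simp
    simp only [hf]
    rw [hηs, hk, abs_neg, abs_of_pos (by positivity), smul_eq_mul, ← mul_assoc]
    congr 1
    have : 0 < (z.re * s - 1) ^ 2 + z.im ^ 2 * s ^ 2 := by positivity
    field_simp
  have e2 : ∀ s ∈ freeSurface, f s = z.im / ((z.re - s) ^ 2 + z.im ^ 2) * w s := fun s hs => by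
    simp only [hf, hη]
    rw [symmExtension_of_one_le (mem_freeSurface.1 hs).le]
  have i1 : IntegrableOn (fun s => z.im / ((z.re - s) ^ 2 + z.im ^ 2) * w s) freeSurface :=
    hfi.integrableOn.congr_fun e2 hS
  have i2 := hcvi.congr_fun e1 hS
  have hR : dirichletHalfPlane η z = (1 / Real.pi) * ∫ t, f t := by
    rw [dirichletHalfPlane, if_pos hz, ← integral_const_mul]
    congr 1; ext t
    simp only [hf]
    rw [mul_comm Real.pi, ← div_div]
    ring
  have hcompl : ∫ t in freeSurfaceᶜ, f t = ∫ t in Set.image (fun s : ℝ => 1 / s) freeSurface, f t :=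
    (setIntegral_congr_set image_one_div_freeSurface_ae_eq).symm
  rw [hR, dirichletOmega, if_pos hz, ← integral_add_compl hS hfi,
    hcompl, hcv, setIntegral_congr_fun hS e1,
    setIntegral_congr_fun hS e2, ← integral_add i1 i2]
  simp_rw [add_mul]

/-- The inversion exchanges the two summands of the kernel, whatever the datum. -/
theorem dirichletOmega_inversion (w : ℝ → ℝ) {x y : ℝ} (hy : 0 < y) :
    dirichletOmega w ⟨x / (x ^ 2 + y ^ 2), y / (x ^ 2 + y ^ 2)⟩ = dirichletOmega w ⟨x, y⟩ := by
  have hr : 0 < x ^ 2 + y ^ 2 := by positivity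
  have hy' : 0 < y / (x ^ 2 + y ^ 2) := by positivity
  rw [dirichletOmega, dirichletOmega, if_pos hy', if_pos hy]
  congr 1
  refine setIntegral_congr_fun isOpen_freeSurface.measurableSet fun t _ => ?_
  have h0 : x ^ 2 + y ^ 2 ≠ 0 := hr.ne'
  have hA : (x / (x ^ 2 + y ^ 2) - t) ^ 2 + (y / (x ^ 2 + y ^ 2)) ^ 2 =
      ((x * t - 1) ^ 2 + y ^ 2 * t ^ 2) / (x ^ 2 + y ^ 2) := by field_simp; ring
  have hB : (x / (x ^ 2 + y ^ 2) * t - 1) ^ 2 + (y / (x ^ 2 + y ^ 2)) ^ 2 * t ^ 2 =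
      ((x - t) ^ 2 + y ^ 2) / (x ^ 2 + y ^ 2) := by field_simp; ring
  simp only [hA, hB, div_div_div_cancel_right₀ h0]
  rw [add_comm]

/-! ### Geometry of the fluid domain and the radial derivative -/

theorem mem_fluidDomain {z : ℂ} : z ∈ fluidDomain ↔ 1 < z.re ^ 2 + z.im ^ 2 ∧ 0 < z.im := Iff.rfl

theorem mem_halfCircle {z : ℂ} : z ∈ halfCircle ↔ z.re ^ 2 + z.im ^ 2 = 1 ∧ 0 < z.im := Iff.rfl

theorem closure_fluidDomain :
    closure fluidDomain = {z | 1 ≤ z.re ^ 2 + z.im ^ 2 ∧ 0 ≤ z.im} := by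
  refine subset_antisymm (closure_minimal (fun z hz => ?_) ?_) fun z hz => ?_
  · have := mem_fluidDomain.1 hz
    exact ⟨this.1.le, this.2.le⟩
  · exact (isClosed_le continuous_const
      ((Complex.continuous_re.pow 2).add (Complex.continuous_im.pow 2))).inter
      (isClosed_le continuous_const Complex.continuous_im)
  · have hz' : 1 ≤ z.re ^ 2 + z.im ^ 2 ∧ 0 ≤ z.im := hz
    -- The path `(1 + s) z + s i` enters the open domain for `s > 0`: the dilation and the upward
    -- shift increase the modulus, and the shift makes the height positive.
    let γ : ℝ → ℂ := fun s => ⟨(1 + s) * z.re, (1 + s) * z.im + s⟩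
    have hγ : Continuous γ := by
      have : γ = fun s : ℝ =>
          (((1 + s) * z.re : ℝ) : ℂ) + (((1 + s) * z.im + s : ℝ) : ℂ) * Complex.I := by
        ext s
        exact (Complex.mk_eq_add_mul_I _ _)
      rw [this]
      fun_prop
    have h0 : γ 0 = z := by apply Complex.ext <;> simp [γ]
    have hcl : (0 : ℝ) ∈ closure (Ioi 0) := by simp
    have hm := map_mem_closure hγ hcl (t := fluidDomain) (fun s hs => by
      have hs' : 0 < s := hs
      refine mem_fluidDomain.2 ⟨?_, ?_⟩
      · change 1 < ((1 + s) * z.re) ^ 2 + ((1 + s) * z.im + s) ^ 2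
        nlinarith [mul_nonneg hs'.le hz'.2, mul_nonneg hs'.le (mul_nonneg hs'.le hz'.2),
          mul_nonneg (sq_nonneg s) (sub_nonneg.2 hz'.1), mul_nonneg hs'.le (sub_nonneg.2 hz'.1),
          pow_pos hs' 2]
      · change 0 < (1 + s) * z.im + s
        nlinarith [mul_nonneg hs'.le hz'.2, hz'.2])
    rwa [h0] at hm

theorem mem_closure_fluidDomain {z : ℂ} :
    z ∈ closure fluidDomain ↔ 1 ≤ z.re ^ 2 + z.im ^ 2 ∧ 0 ≤ z.im := by
  rw [closure_fluidDomain]; exact Iff.rfl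

theorem one_le_abs_re_of_mem_closure {z : ℂ} (hz : z ∈ closure fluidDomain) (h : ¬ 0 < z.im) :
    1 ≤ |z.re| := by
  obtain ⟨h1, h2⟩ := mem_closure_fluidDomain.1 hz
  have h3 : z.im = 0 := le_antisymm (not_lt.1 h) h2
  rw [h3] at h1
  rw [← one_le_sq_iff_one_le_abs]
  simpa using h1

theorem eqOn_dirichletOmega_dirichletHalfPlane {w : ℝ → ℝ} {C : ℝ}
    (hw : ContinuousOn w (closure freeSurface)) (hC : ∀ x, 1 ≤ |x| → |w x| ≤ C) :
    EqOn (dirichletOmega w) (dirichletHalfPlane (symmExtension w)) (closure fluidDomain) := by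
  intro z hz
  by_cases h : 0 < z.im
  · exact dirichletOmega_eq_dirichletHalfPlane hw hC h
  · rw [dirichletOmega, dirichletHalfPlane, if_neg h, if_neg h,
      symmExtension_of_one_le (one_le_abs_re_of_mem_closure hz h)]

theorem dirichletHalfPlane_symmExtension_eq_inversion {w : ℝ → ℝ} {C : ℝ}
    (hw : ContinuousOn w (closure freeSurface)) (hC : ∀ x, 1 ≤ |x| → |w x| ≤ C) {x y : ℝ}
    (hy : 0 ≤ y) (hr0 : 0 < x ^ 2 + y ^ 2) (hr1 : x ^ 2 + y ^ 2 < 1) :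
    dirichletHalfPlane (symmExtension w) ⟨x, y⟩ =
      dirichletOmega w ⟨x / (x ^ 2 + y ^ 2), y / (x ^ 2 + y ^ 2)⟩ := by
  rcases hy.eq_or_lt with rfl | hy
  · have hx : x ≠ 0 := by rintro rfl; simp at hr0
    have hx1 : |x| ≤ 1 := by
      rw [← sq_le_one_iff_abs_le_one]; linarith [hr1, sq_nonneg (0 : ℝ)]
    rw [dirichletHalfPlane, dirichletOmega, if_neg (by simp), if_neg (by simp),
      symmExtension_of_abs_le_one hx1 hx]
    congr 1
    simp only
    field_simp
    ring
  · rw [dirichletOmega_inversion w hy]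
    exact (dirichletOmega_eq_dirichletHalfPlane hw hC (z := ⟨x, y⟩) hy).symm

/-- Needed for `fderivWithin` to be determined on the half-circle. The closed domain is not convex,
so a convex open piece of it with `z` in its closure is used. -/
theorem uniqueDiffWithinAt_closure_fluidDomain {z : ℂ} (hz : z ∈ halfCircle) :
    UniqueDiffWithinAt ℝ (closure fluidDomain) z := by
  obtain ⟨h1, h2⟩ := mem_halfCircle.1 hz
  -- The part of the upper half-plane beyond the tangent at `z`. It lies outside the disc because
  -- `|ζ|² ≥ 2 ⟨z, ζ⟩ - 1`.
  let s : Set ℂ := {ζ | 1 < z.re * ζ.re + z.im * ζ.im} ∩ {ζ | 0 < ζ.im}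
  have hso : IsOpen s := (isOpen_lt continuous_const ((continuous_const.mul
    Complex.continuous_re).add (continuous_const.mul Complex.continuous_im))).inter
    (isOpen_lt continuous_const Complex.continuous_im)
  have hsub : s ⊆ closure fluidDomain := by
    rintro ζ ⟨ha, hb⟩
    rw [mem_ofPred_eq] at ha hb
    refine mem_closure_fluidDomain.2 ⟨?_, hb.le⟩
    nlinarith [sq_nonneg (z.re - ζ.re), sq_nonneg (z.im - ζ.im)]
  have hconv : Convex ℝ s := by
    intro a ha b hb p q hp hq hpq
    obtain ⟨ha1, ha2⟩ := ha
    obtain ⟨hb1, hb2⟩ := hb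
    rw [mem_ofPred_eq] at ha1 ha2 hb1 hb2
    constructor
    · rw [mem_ofPred_eq]
      simp only [Complex.add_re, Complex.add_im, Complex.real_smul, Complex.mul_re, Complex.mul_im,
        Complex.ofReal_re, Complex.ofReal_im, zero_mul, sub_zero, add_zero]
      rcases hp.eq_or_lt with rfl | hp
      · rw [zero_add] at hpq; subst hpq; linarith
      · have := mul_lt_mul_of_pos_left ha1 hp
        have := mul_le_mul_of_nonneg_left hb1.le hq
        linarith
    · rw [mem_ofPred_eq]
      simp only [Complex.add_im, Complex.real_smul, Complex.mul_im,
        Complex.ofReal_re, Complex.ofReal_im, zero_mul, add_zero]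
      rcases hp.eq_or_lt with rfl | hp
      · rw [zero_add] at hpq; subst hpq; linarith
      · have := mul_pos hp ha2
        have := mul_nonneg hq hb2.le
        linarith
  have hmem : ∀ r ∈ Ioi (1 : ℝ), (r : ℂ) * z ∈ s := by
    intro r hr
    rw [mem_Ioi] at hr
    refine ⟨?_, ?_⟩
    · rw [mem_ofPred_eq]
      simp only [Complex.mul_re, Complex.mul_im, Complex.ofReal_re, Complex.ofReal_im, zero_mul,
        sub_zero, add_zero]
      have : z.re * (r * z.re) + z.im * (r * z.im) = r := by linear_combination r * h1
      rwa [this]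
    · rw [mem_ofPred_eq]
      simp only [Complex.mul_im, Complex.ofReal_re, Complex.ofReal_im, zero_mul, add_zero]
      exact mul_pos (by linarith) h2
  have hzs : z ∈ closure s := by
    have hcl : (1 : ℝ) ∈ closure (Ioi 1) := by simp
    have := map_mem_closure (f := fun r : ℝ => (r : ℂ) * z) (by fun_prop) hcl hmem
    simpa using this
  refine (uniqueDiffWithinAt_convex hconv ?_ hzs).mono hsub
  rw [hso.interior_eq]
  exact ⟨_, hmem 2 (by norm_num)⟩

theorem clm_apply_eq_re_smul_add_im_smul {E : Type*} [NormedAddCommGroup E] [NormedSpace ℝ E]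
    (L : ℂ →L[ℝ] E) (z : ℂ) : L z = z.re • L 1 + z.im • L Complex.I := by
  rw [← map_smul, ← map_smul, ← map_add]
  congr 1
  apply Complex.ext <;> simp

theorem radialDeriv_of_mem_halfCircle (ψ : ℂ → ℝ) {z : ℂ} (hz : z ∈ halfCircle) :
    radialDeriv ψ z = fderivWithin ℝ ψ (closure fluidDomain) z z := by
  rw [clm_apply_eq_re_smul_add_im_smul _ z, radialDeriv, (mem_halfCircle.1 hz).1]
  simp

/-! ### Existence -/

section Existence

variable {w : ℝ → ℝ} {C : ℝ}

theorem continuousBounded_dirichletOmega (hw : ContinuousOn w (closure freeSurface))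
    (hC : ∀ x, 1 ≤ |x| → |w x| ≤ C) : ContinuousBounded (dirichletOmega w) := by
  have heq := eqOn_dirichletOmega_dirichletHalfPlane hw hC
  refine ⟨?_, C, fun z hz => ?_⟩
  · refine ContinuousOn.congr (fun z hz => ?_) heq
    obtain ⟨h1, h2⟩ := mem_closure_fluidDomain.1 hz
    refine (continuousWithinAt_dirichletHalfPlane (measurable_symmExtension hw)
      (abs_symmExtension_le hC) (fun x hx => continuousAt_symmExtension hw hx) h2 ?_).mono
      fun y hy => (mem_closure_fluidDomain.1 hy).2
    rintro rfl
    norm_num at h1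
  · rw [heq hz]
    exact abs_dirichletHalfPlane_le (abs_symmExtension_le hC) (mem_closure_fluidDomain.1 hz).2

theorem isOpen_im_pos : IsOpen {z : ℂ | 0 < z.im} :=
  isOpen_lt continuous_const Complex.continuous_im

theorem harmonicOnNhd_dirichletOmega (hw : ContinuousOn w (closure freeSurface))
    (hC : ∀ x, 1 ≤ |x| → |w x| ≤ C) : HarmonicOnNhd (dirichletOmega w) {z | 0 < z.im} := by
  intro z hz
  refine (harmonicAt_congr_nhds ?_).2 (harmonicOnNhd_dirichletHalfPlane
    (measurable_symmExtension hw) (abs_symmExtension_le hC) z hz)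
  filter_upwards [isOpen_im_pos.mem_nhds hz] with y hy
  exact dirichletOmega_eq_dirichletHalfPlane hw hC hy

/-- Along the ray through `z` the function satisfies `f r = f (1 / r)`; differentiating at `r = 1`
gives `f' = -f'`. -/
theorem fderiv_dirichletOmega_apply_self (hw : ContinuousOn w (closure freeSurface))
    (hC : ∀ x, 1 ≤ |x| → |w x| ≤ C) {z : ℂ} (hz : z ∈ halfCircle) :
    fderiv ℝ (dirichletOmega w) z z = 0 := by
  obtain ⟨h1, h2⟩ := mem_halfCircle.1 hz
  have hD : HasFDerivAt (dirichletOmega w) (fderiv ℝ (dirichletOmega w) z) z :=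
    ((harmonicOnNhd_dirichletOmega hw hC z h2).1.differentiableAt (by norm_num)).hasFDerivAt
  set L := fderiv ℝ (dirichletOmega w) z
  let f : ℝ → ℝ := fun r => dirichletOmega w ((r : ℂ) * z)
  have hf : HasDerivAt f (L z) 1 := by
    have hγ : HasDerivAt (fun r : ℝ => (r : ℂ) * z) z 1 := by
      simpa using (Complex.ofRealCLM.hasDerivAt (x := (1 : ℝ))).mul_const z
    exact HasFDerivAt.comp_hasDerivAt (f := fun r : ℝ => (r : ℂ) * z) 1 (by simpa using hD) hγ
  have hsymm : f =ᶠ[nhds 1] fun r => f r⁻¹ := by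
    filter_upwards [Ioi_mem_nhds (zero_lt_one' ℝ)] with r hr
    rw [mem_Ioi] at hr
    have e := dirichletOmega_inversion w (x := r * z.re) (mul_pos hr h2)
    have hr2 : (r * z.re) ^ 2 + (r * z.im) ^ 2 = r ^ 2 := by linear_combination r ^ 2 * h1
    rw [hr2] at e
    have e1 : (⟨r * z.re, r * z.im⟩ : ℂ) = (r : ℂ) * z := by apply Complex.ext <;> simp
    have e2 : (⟨r * z.re / r ^ 2, r * z.im / r ^ 2⟩ : ℂ) = ((r⁻¹ : ℝ) : ℂ) * z := by
      apply Complex.ext <;> simp [-Complex.ofReal_inv] <;> field_simp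
    rw [e1, e2] at e
    exact e.symm
  have hf' : HasDerivAt (fun r => f r⁻¹) (L z * -1) 1 := by
    have hi : HasDerivAt (fun r : ℝ => r⁻¹) (-1) 1 := by
      simpa using hasDerivAt_inv (one_ne_zero (α := ℝ))
    exact HasDerivAt.comp 1 (by simpa using hf) hi
  have := hf.unique (hf'.congr_of_eventuallyEq hsymm)
  linarith

theorem classicalNeumann_dirichletOmega (hw : ContinuousOn w (closure freeSurface))
    (hC : ∀ x, 1 ≤ |x| → |w x| ≤ C) : ClassicalNeumann (dirichletOmega w) := by
  intro z hz
  have hd : DifferentiableAt ℝ (dirichletOmega w) z :=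
    (harmonicOnNhd_dirichletOmega hw hC z (mem_halfCircle.1 hz).2).1.differentiableAt (by norm_num)
  refine ⟨hd.differentiableWithinAt, ?_⟩
  rw [radialDeriv_of_mem_halfCircle _ hz,
    hd.fderivWithin (uniqueDiffWithinAt_closure_fluidDomain hz),
    fderiv_dirichletOmega_apply_self hw hC hz]

/-- Differentiation under the integral sign along the rays through the half-circle. -/
theorem hasDerivAt_integral_ray {ψ : ℂ → ℝ} (hψ : ContDiffOn ℝ 1 ψ {z | 0 < z.im}) {φ : ℝ → ℝ}
    (hφ : Continuous φ) (hφc : HasCompactSupport φ) (hφt : tsupport φ ⊆ Ioo 0 Real.pi) :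
    HasDerivAt (fun r : ℝ => ∫ θ in (0 : ℝ)..Real.pi, ψ ⟨r * Real.cos θ, r * Real.sin θ⟩ * φ θ)
      (∫ θ in (0 : ℝ)..Real.pi,
        fderiv ℝ ψ ⟨Real.cos θ, Real.sin θ⟩ ⟨Real.cos θ, Real.sin θ⟩ * φ θ) 1 := by
  let e : ℝ → ℂ := fun θ => ⟨Real.cos θ, Real.sin θ⟩
  have hec : Continuous e := by
    have : e = fun θ : ℝ => ((Real.cos θ : ℝ) : ℂ) + ((Real.sin θ : ℝ) : ℂ) * Complex.I :=
      funext fun θ => Complex.mk_eq_add_mul_I _ _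
    rw [this]; fun_prop
  have hre : ∀ r θ : ℝ, (⟨r * Real.cos θ, r * Real.sin θ⟩ : ℂ) = (r : ℂ) * e θ := fun r θ => by
    apply Complex.ext <;> simp [e]
  have him : ∀ r : ℝ, 0 < r → ∀ θ ∈ Ioo 0 Real.pi, 0 < ((r : ℂ) * e θ).im := by
    intro r hr θ hθ
    simpa [e] using mul_pos hr (Real.sin_pos_of_mem_Ioo hθ)
  have hd : ∀ z : ℂ, 0 < z.im → HasFDerivAt ψ (fderiv ℝ ψ z) z := fun z hz =>
    ((hψ.differentiableOn (by norm_num)).differentiableAt (isOpen_im_pos.mem_nhds hz)).hasFDerivAt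
  have hdc : ContinuousOn (fderiv ℝ ψ) {z : ℂ | 0 < z.im} :=
    hψ.continuousOn_fderiv_of_isOpen isOpen_im_pos le_rfl
  simp_rw [hre]
  set F : ℝ → ℝ → ℝ := fun r θ => ψ ((r : ℂ) * e θ) * φ θ with hF
  set F' : ℝ → ℝ → ℝ := fun r θ => fderiv ℝ ψ ((r : ℂ) * e θ) (e θ) * φ θ with hF'
  have hzero : ∀ θ, θ ∉ tsupport φ → φ θ = 0 := fun θ => image_eq_zero_of_notMem_tsupport
  have hFc : ∀ r : ℝ, 0 < r → Continuous (F r) := by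
    intro r hr
    refine continuous_iff_continuousAt.2 fun θ => ?_
    by_cases hθ : θ ∈ tsupport φ
    · refine ContinuousAt.mul ?_ hφ.continuousAt
      exact ContinuousAt.comp (f := fun θ => (r : ℂ) * e θ)
        (hd _ (him r hr θ (hφt hθ))).continuousAt (by fun_prop)
    · refine (continuousAt_const (y := (0 : ℝ))).congr ?_
      filter_upwards [(isClosed_tsupport φ).isOpen_compl.mem_nhds hθ] with θ' hθ'
      simp [hF, hzero θ' hθ']
  -- The support of `φ` is compact in `(0, π)`, so these ray points stay in the open half-plane and
  -- the radial derivative is bounded there.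
  have hF'cont : ContinuousOn (fun p : ℝ × ℝ => F' p.1 p.2) (Icc (1 / 2) 2 ×ˢ tsupport φ) := by
    refine ContinuousOn.mul ?_ (hφ.comp continuous_snd).continuousOn
    refine ContinuousOn.clm_apply ?_ (hec.comp continuous_snd).continuousOn
    refine hdc.comp (by fun_prop) fun p hp => ?_
    exact him p.1 (by linarith [hp.1.1]) p.2 (hφt hp.2)
  obtain ⟨B, hB⟩ := (isCompact_Icc.prod hφc.isCompact).exists_bound_of_continuousOn hF'cont
  have hF'1 : Continuous (F' 1) := by
    refine continuous_iff_continuousAt.2 fun θ => ?_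
    by_cases hθ : θ ∈ tsupport φ
    · refine ContinuousAt.mul ?_ hφ.continuousAt
      refine ContinuousAt.clm_apply ?_ hec.continuousAt
      have hm := him 1 one_pos θ (hφt hθ)
      exact ContinuousAt.comp (f := fun θ => ((1 : ℝ) : ℂ) * e θ)
        (hdc.continuousAt (isOpen_im_pos.mem_nhds hm)) (by fun_prop)
    · refine (continuousAt_const (y := (0 : ℝ))).congr ?_
      filter_upwards [(isClosed_tsupport φ).isOpen_compl.mem_nhds hθ] with θ' hθ'
      simp [hF', hzero θ' hθ']
  have hnhds : Icc (1 / 2 : ℝ) 2 ∈ nhds (1 : ℝ) := Icc_mem_nhds (by norm_num) (by norm_num)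
  have key := (intervalIntegral.hasDerivAt_integral_of_dominated_loc_of_deriv_le (𝕜 := ℝ)
    (μ := volume) (a := 0) (b := Real.pi) (F := F) (F' := F') (x₀ := (1 : ℝ))
    (bound := fun _ => |B|) hnhds ?_ ((hFc 1 one_pos).intervalIntegrable _ _)
    hF'1.aestronglyMeasurable ?_ intervalIntegrable_const ?_).2
  · simpa [hF', e] using key
  · filter_upwards [Ioi_mem_nhds (zero_lt_one' ℝ)] with r hr
    exact (hFc r hr).aestronglyMeasurable
  · refine Filter.Eventually.of_forall fun θ _ r hr => ?_
    by_cases hθ : θ ∈ tsupport φ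
    · exact (hB (r, θ) ⟨hr, hθ⟩).trans (le_abs_self B)
    · simp [hF', hzero θ hθ]
  · refine Filter.Eventually.of_forall fun θ _ r hr => ?_
    by_cases hθ : θ ∈ tsupport φ
    · refine HasDerivAt.mul_const ?_ _
      have hγ : HasDerivAt (fun r : ℝ => (r : ℂ) * e θ) (e θ) r := by
        simpa using (Complex.ofRealCLM.hasDerivAt (x := r)).mul_const (e θ)
      exact (hd _ (him r (by linarith [hr.1]) θ (hφt hθ))).comp_hasDerivAt r hγ
    · simpa [hF, hF', hzero θ hθ] using hasDerivAt_const r (0 : ℝ)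

theorem weakNeumann_dirichletOmega (hw : ContinuousOn w (closure freeSurface))
    (hC : ∀ x, 1 ≤ |x| → |w x| ≤ C) : WeakNeumann (dirichletOmega w) := by
  intro φ hφ hφc hφt
  have hcd : ContDiffOn ℝ 1 (dirichletOmega w) {z | 0 < z.im} :=
    (harmonicOnNhd_dirichletOmega hw hC).contDiffOn.of_le (by norm_num)
  have h := (hasDerivAt_integral_ray hcd hφ.continuous hφc hφt).hasDerivWithinAt (s := Ici 1)
  have hz : ∫ θ in (0 : ℝ)..Real.pi, fderiv ℝ (dirichletOmega w) ⟨Real.cos θ, Real.sin θ⟩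
      ⟨Real.cos θ, Real.sin θ⟩ * φ θ = 0 := by
    refine intervalIntegral.integral_zero_ae (Filter.Eventually.of_forall fun θ _ => ?_)
    by_cases hθ : θ ∈ tsupport φ
    · rw [fderiv_dirichletOmega_apply_self hw hC (mem_halfCircle.2 ⟨Real.cos_sq_add_sin_sq θ,
        Real.sin_pos_of_mem_Ioo (hφt hθ)⟩), zero_mul]
    · rw [image_eq_zero_of_notMem_tsupport hθ, mul_zero]
  rwa [hz] at h

theorem trace_dirichletOmega (w : ℝ → ℝ) (x : ℝ) : dirichletOmega w (x : ℂ) = w x := by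
  rw [dirichletOmega, if_neg (by simp)]; simp

theorem fluidDomain_subset_im_pos : fluidDomain ⊆ {z : ℂ | 0 < z.im} :=
  fun _ hz => (mem_fluidDomain.1 hz).2

theorem isClassicalSolution_dirichletOmega (hw : ContinuousOn w (closure freeSurface))
    (hC : ∀ x, 1 ≤ |x| → |w x| ≤ C) : IsClassicalSolution w (dirichletOmega w) :=
  ⟨continuousBounded_dirichletOmega hw hC,
    (harmonicOnNhd_dirichletOmega hw hC).mono fluidDomain_subset_im_pos,
    classicalNeumann_dirichletOmega hw hC, fun x _ => trace_dirichletOmega w x⟩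

theorem isWeakSolution_dirichletOmega (hw : ContinuousOn w (closure freeSurface))
    (hC : ∀ x, 1 ≤ |x| → |w x| ≤ C) : IsWeakSolution w (dirichletOmega w) :=
  ⟨continuousBounded_dirichletOmega hw hC,
    (harmonicOnNhd_dirichletOmega hw hC).mono fluidDomain_subset_im_pos,
    weakNeumann_dirichletOmega hw hC, fun x _ => trace_dirichletOmega w x⟩

end Existence

/-! ### Maximum principle on a half-strip -/

/-- Locally `f` is the real part of a holomorphic `H`, and `H ∘ G` is holomorphic. -/
theorem _root_.InnerProductSpace.HarmonicAt.comp_analyticAt {f : ℂ → ℝ} {G : ℂ → ℂ} {z : ℂ}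
    (hf : HarmonicAt f (G z)) (hG : AnalyticAt ℂ G z) : HarmonicAt (fun ζ => f (G ζ)) z := by
  obtain ⟨R, hR, hball⟩ := Metric.isOpen_iff.1 (isOpen_setOfPred_harmonicAt f) (G z) hf
  obtain ⟨H, hH, hHf⟩ := HarmonicOnNhd.exists_analyticOnNhd_ball_re_eq (f := f) (z := G z) (R := R)
    fun y hy => hball hy
  have h1 : AnalyticAt ℂ (fun ζ => H (G ζ)) z :=
    (hH (G z) (Metric.mem_ball_self hR)).comp hG
  refine (harmonicAt_congr_nhds ?_).2 h1.harmonicAt_re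
  filter_upwards [hG.continuousAt (Metric.ball_mem_nhds _ hR)] with ζ hζ
  exact (hHf hζ).symm

/-- A continuous function that is bounded by `M` on a circle and has average `M` there is equal to
`M` on the circle. -/
theorem eq_of_circleAverage_eq {g : ℂ → ℝ} (hg : Continuous g) {c : ℂ} {R M : ℝ}
    (hle : ∀ θ, g (circleMap c R θ) ≤ M) (havg : Real.circleAverage g c R = M) {θ : ℝ}
    (hθ : θ ∈ Icc 0 (2 * Real.pi)) : g (circleMap c R θ) = M := by
  by_contra hne
  have hlt := lt_of_le_of_ne (hle θ) hne
  have hpos : 0 < 2 * Real.pi := by positivity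
  have h := intervalIntegral.integral_lt_integral_of_continuousOn_of_le_of_exists_lt hpos
    (f := fun θ => g (circleMap c R θ)) (g := fun _ => M)
    (hg.comp (continuous_circleMap c R)).continuousOn continuousOn_const (fun x _ => hle x)
    ⟨θ, hθ, hlt⟩
  rw [Real.circleAverage_def, smul_eq_mul, inv_mul_eq_iff_eq_mul₀ hpos.ne'] at havg
  rw [havg] at h
  simp at h

/-- A positive harmonic function on the strip `0 ≤ θ ≤ π`, growing at infinity, with negative
normal derivative `∂/∂s` on the edge `s = 0`. -/
noncomputable def stripBarrier (ζ : ℂ) : ℝ :=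
  (Complex.exp ((ζ - (Real.pi / 2 : ℝ) * Complex.I) / 2) +
    2 * Complex.exp (-((ζ - (Real.pi / 2 : ℝ) * Complex.I) / 2))).re

theorem stripBarrier_eq (s θ : ℝ) :
    stripBarrier (s + θ * Complex.I) =
      (Real.exp (s / 2) + 2 * Real.exp (-(s / 2))) * Real.cos ((θ - Real.pi / 2) / 2) := by
  have e : ((s : ℂ) + θ * Complex.I - (Real.pi / 2 : ℝ) * Complex.I) / 2 =
      ⟨s / 2, (θ - Real.pi / 2) / 2⟩ := by
    rw [Complex.mk_eq_add_mul_I]; push_cast; ring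
  rw [stripBarrier, e]
  simp only [Complex.add_re, Complex.mul_re, Complex.exp_re, Complex.neg_re, Complex.neg_im,
    Complex.re_ofNat, Complex.im_ofNat, zero_mul, sub_zero, Real.cos_neg]
  ring

theorem harmonicAt_stripBarrier (ζ : ℂ) : HarmonicAt stripBarrier ζ := by
  have : AnalyticAt ℂ (fun ζ : ℂ => Complex.exp ((ζ - (Real.pi / 2 : ℝ) * Complex.I) / 2) +
    2 * Complex.exp (-((ζ - (Real.pi / 2 : ℝ) * Complex.I) / 2))) ζ := by
    refine Differentiable.analyticAt ?_ ζ
    fun_prop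
  exact this.harmonicAt_re

theorem continuous_stripBarrier : Continuous stripBarrier := by
  unfold stripBarrier
  fun_prop

/-- The angle stays within `π / 4`, hence within `π / 3`. The halved frequency keeps the barrier
positive up to the sides. -/
theorem half_le_cos_strip {θ : ℝ} (h : θ ∈ Icc 0 Real.pi) :
    1 / 2 ≤ Real.cos ((θ - Real.pi / 2) / 2) := by
  rw [← Real.cos_pi_div_three, ← Real.cos_abs ((θ - Real.pi / 2) / 2)]
  refine Real.cos_le_cos_of_nonneg_of_le_pi (abs_nonneg _) (by linarith [Real.pi_pos]) ?_
  rw [abs_le]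
  constructor <;> linarith [h.1, h.2, Real.pi_pos]

theorem div_four_le_stripBarrier {ζ : ℂ} (h : ζ.im ∈ Icc 0 Real.pi) :
    ζ.re / 4 ≤ stripBarrier ζ := by
  have hc := half_le_cos_strip h
  have e := stripBarrier_eq ζ.re ζ.im
  rw [Complex.re_add_im] at e
  rw [e]
  have h1 := Real.add_one_le_exp (ζ.re / 2)
  have h2 := Real.exp_pos (ζ.re / 2)
  have h3 := Real.exp_pos (-(ζ.re / 2))
  have : (Real.exp (ζ.re / 2) + 2 * Real.exp (-(ζ.re / 2))) * (1 / 2) ≤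
      (Real.exp (ζ.re / 2) + 2 * Real.exp (-(ζ.re / 2))) * Real.cos ((ζ.im - Real.pi / 2) / 2) :=
    mul_le_mul_of_nonneg_left hc (by positivity)
  linarith

theorem stripBarrier_nonneg {ζ : ℂ} (h : ζ.im ∈ Icc 0 Real.pi) : 0 ≤ stripBarrier ζ := by
  have e := stripBarrier_eq ζ.re ζ.im
  rw [Complex.re_add_im] at e
  rw [e]
  have := half_le_cos_strip h
  positivity

/-- The coefficient `2` of the decaying exponential makes this derivative `1/2 - 1 < 0`; equal
coefficients would give zero. -/
theorem hasDerivAt_stripBarrier (θ : ℝ) :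
    HasDerivAt (fun s : ℝ => stripBarrier (s + θ * Complex.I))
      (-(1 / 2) * Real.cos ((θ - Real.pi / 2) / 2)) 0 := by
  simp_rw [stripBarrier_eq]
  refine HasDerivAt.mul_const ?_ _
  have h1 : HasDerivAt (fun s : ℝ => s / 2) (1 / 2) 0 := (hasDerivAt_id 0).div_const 2
  have h2 := h1.exp.add ((h1.neg.exp).const_mul 2)
  refine h2.congr_deriv ?_
  norm_num

theorem hasDerivWithinAt_nonpos_of_isMaxOn {f : ℝ → ℝ} {f' S : ℝ} (hS : 0 < S)
    (hf : HasDerivWithinAt f f' (Ici 0) 0) (hmax : ∀ s ∈ Icc 0 S, f s ≤ f 0) : f' ≤ 0 := by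
  have h := (hasDerivWithinAt_iff_tendsto_slope' (by simp)).1 hf.Ioi_of_Ici
  refine le_of_tendsto h ?_
  filter_upwards [Ioo_mem_nhdsGT hS] with s hs
  rw [slope_def_field]
  exact div_nonpos_of_nonpos_of_nonneg (by linarith [hmax s ⟨hs.1.le, hs.2.le⟩])
    (by linarith [hs.1])

/-- Maximum principle on the half-strip `s ≥ 0`, `a ≤ θ ≤ b`, for bounded functions with the mean
value property and zero normal derivative on the edge `s = 0`. -/
theorem le_add_stripBarrier {g : ℂ → ℝ} {a b C m ε : ℝ} (ha : 0 ≤ a) (hb : b ≤ Real.pi)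
    (hε : 0 < ε) (hg : Continuous g) (hC : ∀ ζ, g ζ ≤ C)
    (hmv : ∀ ζ : ℂ, 0 < ζ.re → ζ.im ∈ Ioo a b → ∃ R > 0,
      Metric.closedBall ζ R ⊆ {ζ | 0 < ζ.re ∧ ζ.im ∈ Ioo a b} ∧ Real.circleAverage g ζ R = g ζ)
    (hN : ∀ θ ∈ Ioo a b, HasDerivWithinAt (fun s : ℝ => g (s + θ * Complex.I)) 0 (Ici 0) 0)
    (hside : ∀ ζ : ℂ, 0 ≤ ζ.re → ζ.im = a ∨ ζ.im = b → g ζ ≤ m + ε * stripBarrier ζ)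
    {ζ : ℂ} (hre : 0 ≤ ζ.re) (him : ζ.im ∈ Icc a b) : g ζ ≤ m + ε * stripBarrier ζ := by
  by_contra hcon
  have hIcc : ∀ {t : ℝ}, t ∈ Icc a b → t ∈ Icc 0 Real.pi := fun ht =>
    ⟨ha.trans ht.1, ht.2.trans hb⟩
  let k : ℂ → ℝ := fun ζ => g ζ - ε * stripBarrier ζ
  have hk : Continuous k := hg.sub (continuous_const.mul continuous_stripBarrier)
  have hkζ : m < k ζ := by simp only [k]; linarith
  -- For `s ≥ S` the bound `stripBarrier ≥ s / 4` gives `C - ε * stripBarrier ≤ m`, so the maximum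
  -- is sought on a compact rectangle.
  set S : ℝ := max (ζ.re + 1) (4 * (C - m) / ε) with hS
  have hSζ : ζ.re < S := lt_of_lt_of_le (by linarith) (le_max_left _ _)
  have hSpos : 0 < S := hre.trans_lt hSζ
  have hfar : ∀ ξ : ℂ, S ≤ ξ.re → ξ.im ∈ Icc a b → k ξ ≤ m := by
    intro ξ h1 h2
    have h3 := div_four_le_stripBarrier (hIcc h2)
    have h4 : 4 * (C - m) / ε ≤ ξ.re := (le_max_right _ _).trans h1
    rw [div_le_iff₀ hε] at h4
    have h5 := mul_le_mul_of_nonneg_left h3 hε.le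
    have h6 := hC ξ
    simp only [k]
    linarith
  have hK : IsCompact (Icc 0 S ×ℂ Icc a b) := isCompact_Icc.reProdIm isCompact_Icc
  have hζK : ζ ∈ Icc 0 S ×ℂ Icc a b := ⟨⟨hre, hSζ.le⟩, him⟩
  obtain ⟨ζ₁, hζ₁, hmax⟩ := hK.exists_isMaxOn ⟨ζ, hζK⟩ hk.continuousOn
  set M := k ζ₁ with hM
  have hmM : m < M := hkζ.trans_le (hmax hζK)
  have hall : ∀ ξ : ℂ, 0 ≤ ξ.re → ξ.im ∈ Icc a b → k ξ ≤ M := by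
    intro ξ h1 h2
    rcases le_total ξ.re S with h | h
    · exact hmax (show ξ ∈ Icc 0 S ×ℂ Icc a b from ⟨⟨h1, h⟩, h2⟩)
    · exact (hfar ξ h h2).trans hmM.le
  have hT : IsCompact ((Icc 0 S ×ℂ Icc a b) ∩ k ⁻¹' {M}) :=
    hK.inter_right (isClosed_singleton.preimage hk)
  -- Among the maximum points, one with least imaginary part: the mean value property would make the
  -- lowest point of a circle around it another one, a contradiction.
  obtain ⟨ζ₀, ⟨hζ₀, hkζ₀⟩, hmin⟩ := hT.exists_isMinOn ⟨ζ₁, hζ₁, rfl⟩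
    Complex.continuous_im.continuousOn
  have hkζ₀' : k ζ₀ = M := hkζ₀
  obtain ⟨⟨hr0, hrS⟩, hi⟩ : (0 ≤ ζ₀.re ∧ ζ₀.re ≤ S) ∧ ζ₀.im ∈ Icc a b := hζ₀
  have hia : ζ₀.im ≠ a := fun h => by
    have := hside ζ₀ hr0 (Or.inl h)
    simp only [k] at hkζ₀'
    linarith
  have hib : ζ₀.im ≠ b := fun h => by
    have := hside ζ₀ hr0 (Or.inr h)
    simp only [k] at hkζ₀'
    linarith
  have hio : ζ₀.im ∈ Ioo a b := ⟨lt_of_le_of_ne hi.1 (Ne.symm hia), lt_of_le_of_ne hi.2 hib⟩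
  have hrS' : ζ₀.re < S := by
    by_contra h
    have := hfar ζ₀ (not_lt.1 h) hi
    linarith
  rcases hr0.eq_or_lt with h0 | h0
  · have hζ₀eq : ((0 : ℝ) : ℂ) + ζ₀.im * Complex.I = ζ₀ := by
      rw [h0]; exact Complex.re_add_im ζ₀
    -- On the edge the derivative of `k` is `ε / 2` times a positive cosine, impossible at a
    -- maximum.
    have hd := (hN ζ₀.im hio).sub ((hasDerivAt_stripBarrier ζ₀.im).hasDerivWithinAt.const_mul ε)
    have hd' := hasDerivWithinAt_nonpos_of_isMaxOn hSpos hd (fun s hs => by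
      have h1 : k (s + ζ₀.im * Complex.I) ≤ M := hall _ (by simpa using hs.1) (by simpa using hi)
      have h2 : k (((0 : ℝ) : ℂ) + ζ₀.im * Complex.I) = M := by rw [hζ₀eq]; exact hkζ₀'
      exact h1.trans h2.ge)
    have := half_le_cos_strip (hIcc hi)
    nlinarith [mul_pos hε (show (0 : ℝ) < 1 / 2 by norm_num)]
  · obtain ⟨R, hR, hball, havg⟩ := hmv ζ₀ h0 hio
    have hcirc : ∀ θ, circleMap ζ₀ R θ ∈ {ζ : ℂ | 0 < ζ.re ∧ ζ.im ∈ Ioo a b} := fun θ =>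
      hball (Metric.sphere_subset_closedBall (circleMap_mem_sphere ζ₀ hR.le θ))
    have hint : CircleIntegrable g ζ₀ R := hg.continuousOn.circleIntegrable'
    have hbint : CircleIntegrable (ε • stripBarrier) ζ₀ R :=
      (continuous_stripBarrier.const_smul ε).continuousOn.circleIntegrable'
    have hkavg : Real.circleAverage k ζ₀ R = M := by
      have e : k = g - ε • stripBarrier := rfl
      rw [e, Real.circleAverage_sub hint hbint, havg, Real.circleAverage_smul,
        InnerProductSpace.HarmonicOnNhd.circleAverage_eq fun y _ => harmonicAt_stripBarrier y]
      exact hkζ₀'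
    have hθ : 3 * Real.pi / 2 ∈ Icc 0 (2 * Real.pi) := by
      constructor <;> linarith [Real.pi_pos]
    have heq := eq_of_circleAverage_eq hk (M := M)
      (fun θ => hall _ (hcirc θ).1.le ⟨(hcirc θ).2.1.le, (hcirc θ).2.2.le⟩) hkavg hθ
    have hpt : circleMap ζ₀ R (3 * Real.pi / 2) = ζ₀ - R * Complex.I := by
      rw [circleMap, Complex.exp_mul_I, ← Complex.ofReal_cos, ← Complex.ofReal_sin,
        show 3 * Real.pi / 2 = Real.pi / 2 + Real.pi by ring, Real.cos_add_pi, Real.sin_add_pi]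
      simp [sub_eq_add_neg]
    have hmem := hcirc (3 * Real.pi / 2)
    rw [hpt] at heq hmem
    have hre' : (ζ₀ - R * Complex.I).re = ζ₀.re := by simp
    have him' : (ζ₀ - R * Complex.I).im = ζ₀.im - R := by simp
    have := hmin (show ζ₀ - R * Complex.I ∈ (Icc 0 S ×ℂ Icc a b) ∩ k ⁻¹' {M} from
      ⟨⟨by rw [mem_preimage, hre']; exact ⟨hr0, hrS⟩, ⟨hmem.2.1.le, hmem.2.2.le⟩⟩, heq⟩)
    rw [mem_ofPred_eq, him'] at this
    linarith

/-! ### Mollification in the angular variable -/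

theorem exists_mollifier {δ : ℝ} (hδ : 0 < δ) :
    ∃ ρ : ℝ → ℝ, ContDiff ℝ ∞ ρ ∧ (∀ t, 0 ≤ ρ t) ∧
      Function.support ρ ⊆ Ioo (-δ) δ ∧ ∫ t in -δ..δ, ρ t = 1 := by
  let B : ContDiffBump (0 : ℝ) := ⟨δ / 2, δ, by linarith, by linarith⟩
  have hs : Function.support (B.normed volume) ⊆ Ioo (-δ) δ := by
    rw [B.support_normed_eq, Real.ball_eq_Ioo]
    simp [B]
  refine ⟨B.normed volume, B.contDiff_normed, fun t => B.nonneg_normed t, hs, ?_⟩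
  rw [intervalIntegral.integral_eq_integral_of_support_subset (hs.trans Ioo_subset_Ioc_self)]
  exact B.integral_normed

/-- Average of `F` over vertical translations, with weight `ρ`. -/
noncomputable def verticalMollify (ρ : ℝ → ℝ) (δ : ℝ) (F : ℂ → ℝ) (ζ : ℂ) : ℝ :=
  ∫ τ in -δ..δ, ρ τ * F (ζ - τ * Complex.I)

section Mollify

variable {ρ : ℝ → ℝ} {δ : ℝ} {F : ℂ → ℝ}

theorem continuous_verticalMollify (hρ : Continuous ρ) (hF : Continuous F) :
    Continuous (verticalMollify ρ δ F) := by
  unfold verticalMollify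
  exact intervalIntegral.continuous_parametric_intervalIntegral_of_continuous' (by fun_prop) _ _

theorem verticalMollify_le (hδ : 0 < δ) (hρ : Continuous ρ) (hρ0 : ∀ t, 0 ≤ ρ t)
    (hρ1 : ∫ t in -δ..δ, ρ t = 1) (hF : Continuous F) {B : ℝ} {ζ : ℂ}
    (h : ∀ τ ∈ Icc (-δ) δ, F (ζ - τ * Complex.I) ≤ B) : verticalMollify ρ δ F ζ ≤ B := by
  have : verticalMollify ρ δ F ζ ≤ ∫ τ in -δ..δ, ρ τ * B := by
    refine intervalIntegral.integral_mono_on (by linarith)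
      (Continuous.intervalIntegrable (by fun_prop) _ _)
      (Continuous.intervalIntegrable (by fun_prop) _ _)
      fun τ hτ => mul_le_mul_of_nonneg_left (h τ hτ) (hρ0 τ)
  rwa [intervalIntegral.integral_mul_const, hρ1, one_mul] at this

theorem le_verticalMollify (hδ : 0 < δ) (hρ : Continuous ρ) (hρ0 : ∀ t, 0 ≤ ρ t)
    (hρ1 : ∫ t in -δ..δ, ρ t = 1) (hF : Continuous F) {B : ℝ} {ζ : ℂ}
    (h : ∀ τ ∈ Icc (-δ) δ, B ≤ F (ζ - τ * Complex.I)) : B ≤ verticalMollify ρ δ F ζ := by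
  have : ∫ τ in -δ..δ, ρ τ * B ≤ verticalMollify ρ δ F ζ := by
    refine intervalIntegral.integral_mono_on (by linarith)
      (Continuous.intervalIntegrable (by fun_prop) _ _)
      (Continuous.intervalIntegrable (by fun_prop) _ _)
      fun τ hτ => mul_le_mul_of_nonneg_left (h τ hτ) (hρ0 τ)
  rwa [intervalIntegral.integral_mul_const, hρ1, one_mul] at this

/-- Fubini: the circle average commutes with the average over translations. -/
theorem circleAverage_verticalMollify (hδ : 0 < δ) (hρ : Continuous ρ) (hF : Continuous F) {ζ : ℂ}
    {R : ℝ} (h : ∀ τ ∈ Icc (-δ) δ, Real.circleAverage F (ζ - τ * Complex.I) R =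
      F (ζ - τ * Complex.I)) :
    Real.circleAverage (verticalMollify ρ δ F) ζ R = verticalMollify ρ δ F ζ := by
  have hc : Continuous fun p : ℝ × ℝ => ρ p.2 * F (circleMap ζ R p.1 - p.2 * Complex.I) := by
    have := continuous_circleMap ζ R
    fun_prop
  have hswap := intervalIntegral_intervalIntegral_swap (a := 0) (b := 2 * Real.pi) (c := -δ)
    (d := δ) (F := fun θ τ => ρ τ * F (circleMap ζ R θ - τ * Complex.I))
    ((hc.continuousOn.integrableOn_compact (isCompact_uIcc.prod isCompact_uIcc)).mono_set
      (prod_mono uIoc_subset_uIcc uIoc_subset_uIcc))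
  rw [Real.circleAverage_def]
  simp only [verticalMollify]
  rw [hswap, smul_eq_mul, ← intervalIntegral.integral_const_mul]
  refine intervalIntegral.integral_congr fun τ hτ => ?_
  rw [uIcc_of_le (by linarith)] at hτ
  have e : ∀ θ, circleMap ζ R θ - τ * Complex.I = circleMap (ζ - τ * Complex.I) R θ := fun θ => by
    simp only [circleMap]; ring
  simp only [e]
  rw [intervalIntegral.integral_const_mul, ← h τ hτ, Real.circleAverage_def, smul_eq_mul]
  ring

/-- For `θ` at distance more than `δ` from the sides, `σ ↦ ρ (θ - σ)` is an admissible angular test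
function; this makes the weak Neumann condition pointwise for the mollified function. -/
theorem verticalMollify_eq_integral (hs : Function.support ρ ⊆ Ioo (-δ) δ) {s θ : ℝ}
    (hθ : θ ∈ Ioo δ (Real.pi - δ)) :
    verticalMollify ρ δ F (s + θ * Complex.I) =
      ∫ σ in (0 : ℝ)..Real.pi, F (s + σ * Complex.I) * ρ (θ - σ) := by
  have h1 : Function.support (fun τ : ℝ => ρ τ * F (s + θ * Complex.I - τ * Complex.I)) ⊆
      Ioc (-δ) δ := fun τ hτ => Ioo_subset_Ioc_self (hs (left_ne_zero_of_mul hτ))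
  have h2 : Function.support (fun σ : ℝ => F (s + σ * Complex.I) * ρ (θ - σ)) ⊆
      Ioc 0 Real.pi := fun σ hσ => by
    have := hs (right_ne_zero_of_mul hσ)
    exact ⟨by linarith [this.2, hθ.1], by linarith [this.1, hθ.2]⟩
  rw [verticalMollify, intervalIntegral.integral_eq_integral_of_support_subset h1,
    intervalIntegral.integral_eq_integral_of_support_subset h2,
    ← integral_sub_left_eq_self _ volume θ]
  congr 1; ext σ
  rw [mul_comm, show (s : ℂ) + θ * Complex.I - ((θ - σ : ℝ) : ℂ) * Complex.I =
    s + σ * Complex.I by push_cast; ring]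

end Mollify

/-! ### Classical and weak uniqueness on the half-strip -/

/-- The open half-strip `s > 0`, `a < θ < b` in the coordinate `ζ = s + i θ`. -/
def halfStrip (a b : ℝ) : Set ℂ := {ζ | 0 < ζ.re ∧ ζ.im ∈ Ioo a b}

theorem mem_halfStrip {a b : ℝ} {ζ : ℂ} : ζ ∈ halfStrip a b ↔ 0 < ζ.re ∧ ζ.im ∈ Ioo a b := Iff.rfl

theorem isOpen_halfStrip (a b : ℝ) : IsOpen (halfStrip a b) :=
  (isOpen_lt continuous_const Complex.continuous_re).inter
    (isOpen_Ioo.preimage Complex.continuous_im)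

theorem nonpos_of_forall_le_add_mul {x h : ℝ} (hh : 0 ≤ h)
    (hx : ∀ m > 0, ∀ ε > 0, x ≤ m + ε * h) : x ≤ 0 := by
  by_contra hcon
  rw [not_le] at hcon
  have h1 := hx (x / 3) (by linarith) (x / (3 * (h + 1))) (by positivity)
  have h2 : x / (3 * (h + 1)) * h ≤ x / 3 := by
    rw [div_mul_eq_mul_div, div_le_div_iff₀ (by positivity) (by norm_num)]
    nlinarith
  linarith

section Strip

variable {F : ℂ → ℝ} {C : ℝ}

theorem nonpos_of_classical_strip (hF : Continuous F) (hC : ∀ ζ, F ζ ≤ C)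
    (hmv : ∀ ζ R, 0 < R → Metric.closedBall ζ R ⊆ halfStrip 0 Real.pi →
      Real.circleAverage F ζ R = F ζ)
    (hN : ∀ θ ∈ Ioo 0 Real.pi,
      HasDerivWithinAt (fun s : ℝ => F (s + θ * Complex.I)) 0 (Ici 0) 0)
    (hside : ∀ ζ : ℂ, 0 ≤ ζ.re → ζ.im = 0 ∨ ζ.im = Real.pi → F ζ = 0)
    {ζ : ℂ} (hre : 0 ≤ ζ.re) (him : ζ.im ∈ Icc 0 Real.pi) : F ζ ≤ 0 := by
  refine nonpos_of_forall_le_add_mul (stripBarrier_nonneg him) fun m hm ε hε => ?_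
  refine le_add_stripBarrier le_rfl le_rfl hε hF hC ?_ hN ?_ hre him
  · intro ξ h1 h2
    obtain ⟨R, hR, hball⟩ := Metric.nhds_basis_closedBall.mem_iff.1
      ((isOpen_halfStrip 0 Real.pi).mem_nhds (mem_halfStrip.2 ⟨h1, h2⟩))
    exact ⟨R, hR, hball, hmv ξ R hR hball⟩
  · intro ξ h1 h2
    rw [hside ξ h1 h2]
    have : 0 ≤ stripBarrier ξ := stripBarrier_nonneg (by
      rcases h2 with h | h <;> rw [h] <;> constructor <;> linarith [Real.pi_pos])
    positivity

/-- The maximum principle is applied to the mollified function on `δ ≤ θ ≤ π - δ`. Uniform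
continuity costs at most `m / 2` on the sides and `m / 2` in returning to `F`. -/
theorem nonpos_of_weak_strip (hF : Continuous F) (hC : ∀ ζ, F ζ ≤ C)
    (hmv : ∀ ζ R, 0 < R → Metric.closedBall ζ R ⊆ halfStrip 0 Real.pi →
      Real.circleAverage F ζ R = F ζ)
    (hN : ∀ φ : ℝ → ℝ, ContDiff ℝ ∞ φ → HasCompactSupport φ → tsupport φ ⊆ Ioo 0 Real.pi →
      HasDerivWithinAt (fun s : ℝ => ∫ θ in (0 : ℝ)..Real.pi, F (s + θ * Complex.I) * φ θ) 0
        (Ici 0) 0)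
    (hside : ∀ ζ : ℂ, 0 ≤ ζ.re → ζ.im = 0 ∨ ζ.im = Real.pi → F ζ = 0)
    {ζ : ℂ} (hre : 0 ≤ ζ.re) (him : ζ.im ∈ Icc 0 Real.pi) : F ζ ≤ 0 := by
  by_cases hi0 : ζ.im = 0 ∨ ζ.im = Real.pi
  · exact (hside ζ hre hi0).le
  rw [not_or] at hi0
  have hζo : ζ.im ∈ Ioo 0 Real.pi :=
    ⟨lt_of_le_of_ne him.1 (Ne.symm hi0.1), lt_of_le_of_ne him.2 hi0.2⟩
  refine nonpos_of_forall_le_add_mul (stripBarrier_nonneg him) fun m hm ε hε => ?_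
  -- Uniform continuity is available only up to `s = S`; beyond it `C ≤ ε * stripBarrier`.
  set S : ℝ := max ζ.re (4 * C / ε) with hS
  have hK : IsCompact (Icc 0 S ×ℂ Icc 0 Real.pi) := isCompact_Icc.reProdIm isCompact_Icc
  obtain ⟨d, hd, hunif⟩ := Metric.uniformContinuousOn_iff.1
    (hK.uniformContinuousOn_of_continuous hF.continuousOn) (m / 2) (by linarith)
  -- The factor `2`: a point at distance `δ` from a side, translated by at most `δ`, ends within `2
  -- * δ` of that side.
  obtain ⟨δ, hδ, hδd, hδ1, hδ2⟩ : ∃ δ : ℝ, 0 < δ ∧ 2 * δ < d ∧ δ < ζ.im ∧ δ < Real.pi - ζ.im := by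
    have h1 : 0 < min (d / 2) (min ζ.im (Real.pi - ζ.im)) :=
      lt_min (by linarith) (lt_min hζo.1 (by linarith [hζo.2]))
    obtain ⟨δ, hδ, hδ'⟩ := exists_between h1
    exact ⟨δ, hδ, by linarith [hδ'.trans_le (min_le_left _ _)],
      hδ'.trans_le ((min_le_right _ _).trans (min_le_left _ _)),
      hδ'.trans_le ((min_le_right _ _).trans (min_le_right _ _))⟩
  obtain ⟨ρ, hρs, hρ0, hρsupp, hρ1⟩ := exists_mollifier hδ
  have hρ : Continuous ρ := hρs.continuous
  have hnear : ∀ s θ₁ θ₂ : ℝ, s ∈ Icc 0 S → θ₁ ∈ Icc 0 Real.pi → θ₂ ∈ Icc 0 Real.pi →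
      |θ₁ - θ₂| ≤ 2 * δ → |F (s + θ₁ * Complex.I) - F (s + θ₂ * Complex.I)| < m / 2 := by
    intro s θ₁ θ₂ hs h₁ h₂ h
    have hmem : ∀ θ ∈ Icc 0 Real.pi, (s : ℂ) + (θ : ℝ) * Complex.I ∈ Icc 0 S ×ℂ Icc 0 Real.pi := by
      intro θ hθ
      rw [Complex.mem_reProdIm]
      simpa using ⟨hs, hθ⟩
    refine hunif _ (hmem θ₁ h₁) _ (hmem θ₂ h₂) ?_
    have : (s : ℂ) + θ₁ * Complex.I - (s + θ₂ * Complex.I) = ((θ₁ - θ₂ : ℝ) : ℂ) * Complex.I := by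
      push_cast; ring
    rw [dist_eq_norm, this, norm_mul, Complex.norm_I, mul_one, Complex.norm_real, Real.norm_eq_abs]
    linarith
  have htrans : ∀ (ξ : ℂ) (τ : ℝ), ξ - τ * Complex.I = (ξ.re : ℂ) + (ξ.im - τ : ℝ) * Complex.I :=
    fun ξ τ => by apply Complex.ext <;> simp
  have hmoll : verticalMollify ρ δ F ζ ≤ m / 2 + ε * stripBarrier ζ := by
    refine le_add_stripBarrier (a := δ) (b := Real.pi - δ) (C := C) hδ.le (by linarith) hε
      (continuous_verticalMollify hρ hF)
      (fun ξ => verticalMollify_le hδ hρ hρ0 hρ1 hF fun τ _ => hC _) ?_ ?_ ?_ hre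
      ⟨hδ1.le, by linarith⟩
    · intro ξ h1 h2
      obtain ⟨R, hR, hball⟩ := Metric.nhds_basis_closedBall.mem_iff.1
        ((isOpen_halfStrip δ (Real.pi - δ)).mem_nhds (mem_halfStrip.2 ⟨h1, h2⟩))
      refine ⟨R, hR, hball, circleAverage_verticalMollify hδ hρ hF fun τ hτ => ?_⟩
      refine hmv _ R hR fun x hx => ?_
      have hx' : x + τ * Complex.I ∈ Metric.closedBall ξ R := by
        rw [Metric.mem_closedBall, dist_eq_norm] at hx ⊢
        rwa [show x + τ * Complex.I - ξ = x - (ξ - τ * Complex.I) by ring]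
      obtain ⟨h3, h4⟩ := mem_halfStrip.1 (hball hx')
      simp only [Complex.add_re, Complex.mul_re, Complex.ofReal_re, Complex.I_re, mul_zero,
        Complex.ofReal_im, Complex.I_im, mul_one, sub_self, add_zero, Complex.add_im,
        Complex.mul_im] at h3 h4
      exact mem_halfStrip.2 ⟨h3, by linarith [h4.1, hτ.2], by linarith [h4.2, hτ.1]⟩
    · intro θ hθ
      have hsub : tsupport (fun σ => ρ (θ - σ)) ⊆ Icc (θ - δ) (θ + δ) := by
        refine closure_minimal (fun σ hσ => ?_) isClosed_Icc
        have := hρsupp (show θ - σ ∈ Function.support ρ from hσ)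
        exact ⟨by linarith [this.2], by linarith [this.1]⟩
      have h := hN (fun σ => ρ (θ - σ)) (hρs.comp (contDiff_const.sub contDiff_id))
        (HasCompactSupport.of_support_subset_isCompact isCompact_Icc
          ((subset_tsupport _).trans hsub))
        (hsub.trans fun σ hσ => ⟨by linarith [hσ.1, hθ.1], by linarith [hσ.2, hθ.2]⟩)
      refine h.congr (fun s _ => verticalMollify_eq_integral hρsupp hθ)
        (verticalMollify_eq_integral hρsupp hθ)
    · intro ξ h1 h2
      have hξ : ξ.im ∈ Icc 0 Real.pi := by
        rcases h2 with h | h <;> rw [h] <;> constructor <;> linarith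
      rcases le_total ξ.re S with hs | hs
      · have hle : verticalMollify ρ δ F ξ ≤ m / 2 := by
          refine verticalMollify_le hδ hρ hρ0 hρ1 hF fun τ hτ => ?_
          rw [htrans]
          rcases h2 with h | h
          · have h5 := hnear ξ.re (ξ.im - τ) 0 ⟨h1, hs⟩
              ⟨by linarith [hτ.2], by linarith [hτ.1]⟩ ⟨le_rfl, Real.pi_pos.le⟩ (by
                rw [abs_le]; constructor <;> linarith [hτ.1, hτ.2])
            rw [hside (ξ.re + (0 : ℝ) * Complex.I) (by simpa using h1) (Or.inl (by simp))] at h5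
            linarith [(abs_lt.1 h5).2]
          · have h5 := hnear ξ.re (ξ.im - τ) Real.pi ⟨h1, hs⟩
              ⟨by linarith [hτ.2], by linarith [hτ.1]⟩ ⟨Real.pi_pos.le, le_rfl⟩ (by
                rw [abs_le]; constructor <;> linarith [hτ.1, hτ.2])
            rw [hside (ξ.re + Real.pi * Complex.I) (by simpa using h1) (Or.inr (by simp))] at h5
            linarith [(abs_lt.1 h5).2]
        have := mul_nonneg hε.le (stripBarrier_nonneg hξ)
        linarith
      · have hle : verticalMollify ρ δ F ξ ≤ C :=
          verticalMollify_le hδ hρ hρ0 hρ1 hF fun τ _ => hC _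
        have h4 : 4 * C / ε ≤ ξ.re := (le_max_right _ _).trans hs
        rw [div_le_iff₀ hε] at h4
        have h5 := mul_le_mul_of_nonneg_left (div_four_le_stripBarrier hξ) hε.le
        linarith
  have hlow : F ζ - m / 2 ≤ verticalMollify ρ δ F ζ := by
    refine le_verticalMollify hδ hρ hρ0 hρ1 hF fun τ hτ => ?_
    have h5 := hnear ζ.re (ζ.im - τ) ζ.im ⟨hre, le_max_left _ _⟩
      ⟨by linarith [hτ.2], by linarith [hτ.1]⟩ him (by
        rw [abs_le]; constructor <;> linarith [hτ.1, hτ.2])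
    rw [Complex.re_add_im] at h5
    rw [htrans]
    linarith [(abs_lt.1 h5).1]
  linarith

end Strip

/-! ### Exponential coordinates and uniqueness in the fluid domain -/

/-- Nearest-point retraction onto the closed half-strip `s ≥ 0`, `0 ≤ θ ≤ π`. -/
noncomputable def stripRetraction (ζ : ℂ) : ℂ :=
  (max ζ.re 0 : ℝ) + (max 0 (min ζ.im Real.pi) : ℝ) * Complex.I

theorem continuous_stripRetraction : Continuous stripRetraction := by
  unfold stripRetraction
  fun_prop

theorem stripRetraction_of_mem {ζ : ℂ} (hre : 0 ≤ ζ.re) (him : ζ.im ∈ Icc 0 Real.pi) :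
    stripRetraction ζ = ζ := by
  rw [stripRetraction, max_eq_left hre, min_eq_left him.2, max_eq_right him.1, Complex.re_add_im]

theorem exp_mem_closure_fluidDomain {ζ : ℂ} (hre : 0 ≤ ζ.re) (him : ζ.im ∈ Icc 0 Real.pi) :
    Complex.exp ζ ∈ closure fluidDomain := by
  rw [mem_closure_fluidDomain, Complex.exp_re, Complex.exp_im]
  have h1 := Real.one_le_exp hre
  refine ⟨?_, mul_nonneg (Real.exp_pos _).le (Real.sin_nonneg_of_mem_Icc him)⟩
  have : (Real.exp ζ.re * Real.cos ζ.im) ^ 2 + (Real.exp ζ.re * Real.sin ζ.im) ^ 2 =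
      Real.exp ζ.re ^ 2 := by linear_combination Real.exp ζ.re ^ 2 * Real.cos_sq_add_sin_sq ζ.im
  rw [this]
  nlinarith

theorem exp_mem_fluidDomain {ζ : ℂ} (h : ζ ∈ halfStrip 0 Real.pi) :
    Complex.exp ζ ∈ fluidDomain := by
  obtain ⟨hre, him⟩ := mem_halfStrip.1 h
  rw [mem_fluidDomain, Complex.exp_re, Complex.exp_im]
  have h1 := Real.one_lt_exp_iff.2 hre
  refine ⟨?_, mul_pos (Real.exp_pos _) (Real.sin_pos_of_mem_Ioo him)⟩
  have : (Real.exp ζ.re * Real.cos ζ.im) ^ 2 + (Real.exp ζ.re * Real.sin ζ.im) ^ 2 =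
      Real.exp ζ.re ^ 2 := by linear_combination Real.exp ζ.re ^ 2 * Real.cos_sq_add_sin_sq ζ.im
  rw [this]
  nlinarith

theorem exp_stripRetraction_mem (ζ : ℂ) :
    Complex.exp (stripRetraction ζ) ∈ closure fluidDomain := by
  refine exp_mem_closure_fluidDomain ?_ ?_
  · simp [stripRetraction]
  · simp [stripRetraction, Real.pi_pos.le]

/-- The principal logarithm works: its real part is `log |z| ≥ 0`, and the argument lies in `[0, π]`
when `Im z ≥ 0`. -/
theorem exists_exp_eq_of_mem_closure {z : ℂ} (hz : z ∈ closure fluidDomain) :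
    ∃ ζ : ℂ, 0 ≤ ζ.re ∧ ζ.im ∈ Icc 0 Real.pi ∧ Complex.exp ζ = z := by
  obtain ⟨h1, h2⟩ := mem_closure_fluidDomain.1 hz
  have h0 : z ≠ 0 := by rintro rfl; norm_num at h1
  refine ⟨Complex.log z, ?_, ?_, Complex.exp_log h0⟩
  · rw [Complex.log_re]
    refine Real.log_nonneg ?_
    rw [Complex.norm_def, Complex.normSq_apply]
    exact Real.one_le_sqrt.2 (by nlinarith)
  · rw [Complex.log_im]
    exact ⟨Complex.arg_nonneg_iff.2 h2, Complex.arg_le_pi z⟩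

theorem exp_add_mul_I_eq_mk (s θ : ℝ) :
    Complex.exp (s + θ * Complex.I) = ⟨Real.exp s * Real.cos θ, Real.exp s * Real.sin θ⟩ := by
  apply Complex.ext <;> simp [Complex.exp_re, Complex.exp_im]

section Uniqueness

variable {u : ℂ → ℝ}

/-- The pull-back of a function on the closed fluid domain under the exponential map, extended
continuously from the closed half-strip to the plane. -/
noncomputable def stripPullback (u : ℂ → ℝ) (ζ : ℂ) : ℝ := u (Complex.exp (stripRetraction ζ))

theorem stripPullback_of_mem {ζ : ℂ} (hre : 0 ≤ ζ.re) (him : ζ.im ∈ Icc 0 Real.pi) :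
    stripPullback u ζ = u (Complex.exp ζ) := by
  rw [stripPullback, stripRetraction_of_mem hre him]

theorem continuous_stripPullback (hu : ContinuousOn u (closure fluidDomain)) :
    Continuous (stripPullback u) :=
  hu.comp_continuous (Complex.continuous_exp.comp continuous_stripRetraction)
    exp_stripRetraction_mem

theorem harmonicOnNhd_stripPullback (hu : HarmonicOnNhd u fluidDomain) :
    HarmonicOnNhd (stripPullback u) (halfStrip 0 Real.pi) := by
  intro ζ hζ
  refine (harmonicAt_congr_nhds ?_).2
    ((hu _ (exp_mem_fluidDomain hζ)).comp_analyticAt (Complex.differentiable_exp.analyticAt ζ))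
  filter_upwards [(isOpen_halfStrip 0 Real.pi).mem_nhds hζ] with ξ hξ
  obtain ⟨h1, h2⟩ := mem_halfStrip.1 hξ
  exact stripPullback_of_mem h1.le ⟨h2.1.le, h2.2.le⟩

theorem circleAverage_stripPullback (hu : HarmonicOnNhd u fluidDomain) {ζ : ℂ} {R : ℝ} (hR : 0 < R)
    (hball : Metric.closedBall ζ R ⊆ halfStrip 0 Real.pi) :
    Real.circleAverage (stripPullback u) ζ R = stripPullback u ζ :=
  InnerProductSpace.HarmonicOnNhd.circleAverage_eq
    ((harmonicOnNhd_stripPullback hu).mono (by rwa [abs_of_pos hR]))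

theorem stripPullback_side (htr : ∀ x : ℝ, 1 ≤ |x| → u (x : ℂ) = 0) {ζ : ℂ} (hre : 0 ≤ ζ.re)
    (h : ζ.im = 0 ∨ ζ.im = Real.pi) : stripPullback u ζ = 0 := by
  have hx := Real.one_le_exp hre
  have hπ := Real.pi_pos.le
  rw [stripPullback_of_mem hre (by rcases h with h | h <;> rw [h] <;> simp [hπ]),
    ← Complex.re_add_im ζ, exp_add_mul_I_eq_mk]
  rcases h with h | h
  · have e : (⟨Real.exp ζ.re * Real.cos ζ.im, Real.exp ζ.re * Real.sin ζ.im⟩ : ℂ) =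
        ((Real.exp ζ.re : ℝ) : ℂ) := by rw [h]; apply Complex.ext <;> simp [-Complex.ofReal_exp]
    rw [e]
    exact htr _ (by rw [abs_of_pos (Real.exp_pos _)]; exact hx)
  · have e : (⟨Real.exp ζ.re * Real.cos ζ.im, Real.exp ζ.re * Real.sin ζ.im⟩ : ℂ) =
        ((-Real.exp ζ.re : ℝ) : ℂ) := by rw [h]; apply Complex.ext <;> simp [-Complex.ofReal_exp]
    rw [e]
    exact htr _ (by rw [abs_neg, abs_of_pos (Real.exp_pos _)]; exact hx)

/-- The curve `s ↦ exp (s + i θ)` has velocity `z` at its starting point `z`, which is the radial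
direction. -/
theorem hasDerivWithinAt_stripPullback_of_classicalNeumann (hN : ClassicalNeumann u) {θ : ℝ}
    (hθ : θ ∈ Ioo 0 Real.pi) :
    HasDerivWithinAt (fun s : ℝ => stripPullback u (s + θ * Complex.I)) 0 (Ici 0) 0 := by
  set z : ℂ := Complex.exp (((0 : ℝ) : ℂ) + θ * Complex.I) with hz
  have hze : z = ⟨Real.cos θ, Real.sin θ⟩ := by rw [hz, exp_add_mul_I_eq_mk]; simp
  have hzc : z ∈ halfCircle := by
    rw [mem_halfCircle, hze]
    exact ⟨Real.cos_sq_add_sin_sq θ, Real.sin_pos_of_mem_Ioo hθ⟩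
  obtain ⟨hd, hr⟩ := hN z hzc
  rw [radialDeriv_of_mem_halfCircle u hzc] at hr
  have hγ : HasDerivAt (fun s : ℝ => Complex.exp ((s : ℂ) + θ * Complex.I)) z 0 := by
    have h1 : HasDerivAt (fun s : ℝ => (s : ℂ) + θ * Complex.I) 1 0 :=
      (Complex.ofRealCLM.hasDerivAt (x := (0 : ℝ))).add_const _
    simpa [hz] using h1.cexp
  have hmem : ∀ s : ℝ, 0 ≤ s → 0 ≤ ((s : ℂ) + θ * Complex.I).re ∧
      ((s : ℂ) + θ * Complex.I).im ∈ Icc 0 Real.pi := fun s hs => by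
    simpa using ⟨hs, hθ.1.le, hθ.2.le⟩
  have h := HasFDerivWithinAt.comp_hasDerivWithinAt (t := closure fluidDomain) (0 : ℝ)
    (f := fun s : ℝ => Complex.exp ((s : ℂ) + θ * Complex.I)) hd.hasFDerivWithinAt
    (hγ.hasDerivWithinAt (s := Ici 0))
    (fun s hs => exp_mem_closure_fluidDomain (hmem s hs).1 (hmem s hs).2)
  rw [hr] at h
  exact h.congr (fun s hs => stripPullback_of_mem (hmem s hs).1 (hmem s hs).2)
    (stripPullback_of_mem (hmem 0 le_rfl).1 (hmem 0 le_rfl).2)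

/-- Chain rule for `r = exp s`, which maps `[0, ∞)` into `[1, ∞)`. -/
theorem hasDerivWithinAt_stripPullback_of_weakNeumann (hN : WeakNeumann u) {φ : ℝ → ℝ}
    (hφ : ContDiff ℝ ∞ φ) (hφc : HasCompactSupport φ) (hφt : tsupport φ ⊆ Ioo 0 Real.pi) :
    HasDerivWithinAt
      (fun s : ℝ => ∫ θ in (0 : ℝ)..Real.pi, stripPullback u (s + θ * Complex.I) * φ θ) 0
      (Ici 0) 0 := by
  have h := HasDerivWithinAt.comp (0 : ℝ) (h := Real.exp) (s' := Ici 1)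
    (by simpa using hN φ hφ hφc hφt) ((Real.hasDerivAt_exp 0).hasDerivWithinAt (s := Ici 0))
    (fun s hs => Real.one_le_exp hs)
  rw [zero_mul] at h
  have e : ∀ s : ℝ, 0 ≤ s → ∫ θ in (0 : ℝ)..Real.pi, stripPullback u (s + θ * Complex.I) * φ θ =
      ∫ θ in (0 : ℝ)..Real.pi, u ⟨Real.exp s * Real.cos θ, Real.exp s * Real.sin θ⟩ * φ θ := by
    intro s hs
    refine intervalIntegral.integral_congr fun θ hθ => ?_
    rw [uIcc_of_le Real.pi_pos.le] at hθ
    rw [stripPullback_of_mem (by simpa using hs) (by simpa using hθ), exp_add_mul_I_eq_mk]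
  exact h.congr (fun s hs => e s hs) (e 0 le_rfl)

/-- A bounded solution of the homogeneous mixed problem is nonpositive. -/
theorem nonpos_of_homogeneous (hcb : ContinuousBounded u) (hu : HarmonicOnNhd u fluidDomain)
    (hN : ClassicalNeumann u ∨ WeakNeumann u) (htr : ∀ x : ℝ, 1 ≤ |x| → u (x : ℂ) = 0) {z : ℂ}
    (hz : z ∈ closure fluidDomain) : u z ≤ 0 := by
  obtain ⟨hc, C, hC⟩ := hcb
  obtain ⟨ζ, hre, him, rfl⟩ := exists_exp_eq_of_mem_closure hz
  rw [← stripPullback_of_mem (u := u) hre him]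
  have hF := continuous_stripPullback hc
  have hFC : ∀ ζ, stripPullback u ζ ≤ C := fun ζ =>
    (le_abs_self _).trans (hC _ (exp_stripRetraction_mem ζ))
  rcases hN with hN | hN
  · exact nonpos_of_classical_strip hF hFC
      (fun ζ R hR hb => circleAverage_stripPullback hu hR hb)
      (fun θ hθ => hasDerivWithinAt_stripPullback_of_classicalNeumann hN hθ)
      (fun ζ h1 h2 => stripPullback_side htr h1 h2) hre him
  · exact nonpos_of_weak_strip hF hFC
      (fun ζ R hR hb => circleAverage_stripPullback hu hR hb)
      (fun φ h1 h2 h3 => hasDerivWithinAt_stripPullback_of_weakNeumann hN h1 h2 h3)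
      (fun ζ h1 h2 => stripPullback_side htr h1 h2) hre him

theorem ContinuousBounded.sub {u₁ u₂ : ℂ → ℝ} (h₁ : ContinuousBounded u₁)
    (h₂ : ContinuousBounded u₂) : ContinuousBounded (u₁ - u₂) := by
  obtain ⟨c₁, C₁, b₁⟩ := h₁
  obtain ⟨c₂, C₂, b₂⟩ := h₂
  exact ⟨c₁.sub c₂, C₁ + C₂, fun z hz => (abs_sub _ _).trans (add_le_add (b₁ z hz) (b₂ z hz))⟩

theorem ClassicalNeumann.sub {u₁ u₂ : ℂ → ℝ} (h₁ : ClassicalNeumann u₁)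
    (h₂ : ClassicalNeumann u₂) : ClassicalNeumann (u₁ - u₂) := by
  intro z hz
  obtain ⟨d₁, r₁⟩ := h₁ z hz
  obtain ⟨d₂, r₂⟩ := h₂ z hz
  refine ⟨d₁.sub d₂, ?_⟩
  rw [radialDeriv_of_mem_halfCircle _ hz] at r₁ r₂ ⊢
  rw [fderivWithin_sub (uniqueDiffWithinAt_closure_fluidDomain hz) d₁ d₂,
    sub_apply, r₁, r₂, sub_zero]

theorem intervalIntegrable_ray {u : ℂ → ℝ} (hc : ContinuousOn u (closure fluidDomain)) {φ : ℝ → ℝ}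
    (hφ : Continuous φ) {r : ℝ} (hr : 1 ≤ r) :
    IntervalIntegrable (fun θ => u ⟨r * Real.cos θ, r * Real.sin θ⟩ * φ θ) volume 0 Real.pi := by
  refine ContinuousOn.intervalIntegrable (ContinuousOn.mul (hc.comp ?_ ?_) hφ.continuousOn)
  · refine Continuous.continuousOn ?_
    have : (fun θ : ℝ => (⟨r * Real.cos θ, r * Real.sin θ⟩ : ℂ)) = fun θ : ℝ =>
        ((r * Real.cos θ : ℝ) : ℂ) + ((r * Real.sin θ : ℝ) : ℂ) * Complex.I :=
      funext fun θ => Complex.mk_eq_add_mul_I _ _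
    rw [this]; fun_prop
  · intro θ hθ
    rw [uIcc_of_le Real.pi_pos.le] at hθ
    refine mem_closure_fluidDomain.2 ⟨?_, mul_nonneg (by linarith) (Real.sin_nonneg_of_mem_Icc hθ)⟩
    have : (r * Real.cos θ) ^ 2 + (r * Real.sin θ) ^ 2 = r ^ 2 := by
      linear_combination r ^ 2 * Real.cos_sq_add_sin_sq θ
    simp only
    rw [this]
    nlinarith

theorem WeakNeumann.sub {u₁ u₂ : ℂ → ℝ} (c₁ : ContinuousOn u₁ (closure fluidDomain))
    (c₂ : ContinuousOn u₂ (closure fluidDomain)) (h₁ : WeakNeumann u₁) (h₂ : WeakNeumann u₂) :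
    WeakNeumann (u₁ - u₂) := by
  intro φ hφ hφc hφt
  have h := (h₁ φ hφ hφc hφt).sub (h₂ φ hφ hφc hφt)
  rw [sub_zero] at h
  have e : ∀ r : ℝ, 1 ≤ r →
      ∫ θ in (0 : ℝ)..Real.pi, (u₁ - u₂) ⟨r * Real.cos θ, r * Real.sin θ⟩ * φ θ =
      (∫ θ in (0 : ℝ)..Real.pi, u₁ ⟨r * Real.cos θ, r * Real.sin θ⟩ * φ θ) -
      ∫ θ in (0 : ℝ)..Real.pi, u₂ ⟨r * Real.cos θ, r * Real.sin θ⟩ * φ θ := by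
    intro r hr
    rw [← intervalIntegral.integral_sub (intervalIntegrable_ray c₁ hφ.continuous hr)
      (intervalIntegrable_ray c₂ hφ.continuous hr)]
    simp only [Pi.sub_apply, sub_mul]
  exact h.congr (fun r hr => e r hr) (e 1 le_rfl)

theorem ofReal_mem_closure_fluidDomain {x : ℝ} (hx : 1 ≤ |x|) :
    (x : ℂ) ∈ closure fluidDomain := by
  rw [mem_closure_fluidDomain]
  simpa using hx

/-- Two bounded continuous functions that agree on the free surface agree on its closure. -/
theorem eq_on_closed_freeSurface {u₁ u₂ : ℂ → ℝ} (c₁ : ContinuousOn u₁ (closure fluidDomain))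
    (c₂ : ContinuousOn u₂ (closure fluidDomain))
    (h : ∀ x ∈ freeSurface, u₁ (x : ℂ) = u₂ (x : ℂ)) {x : ℝ} (hx : 1 ≤ |x|) :
    u₁ (x : ℂ) = u₂ (x : ℂ) := by
  have hmaps : MapsTo (fun x : ℝ => (x : ℂ)) (closure freeSurface) (closure fluidDomain) := by
    rw [closure_freeSurface]
    exact fun y hy => ofReal_mem_closure_fluidDomain hy
  have heq : EqOn (fun x : ℝ => u₁ (x : ℂ)) (fun x : ℝ => u₂ (x : ℂ)) (closure freeSurface) :=
    EqOn.of_subset_closure (fun y hy => h y hy)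
      (c₁.comp Complex.continuous_ofReal.continuousOn hmaps)
      (c₂.comp Complex.continuous_ofReal.continuousOn hmaps) subset_closure subset_rfl
  exact heq (by rw [closure_freeSurface]; exact hx)

theorem eqOn_of_neumann {u₁ u₂ : ℂ → ℝ} (b₁ : ContinuousBounded u₁) (b₂ : ContinuousBounded u₂)
    (h₁ : HarmonicOnNhd u₁ fluidDomain) (h₂ : HarmonicOnNhd u₂ fluidDomain)
    (hN : ClassicalNeumann u₁ ∧ ClassicalNeumann u₂ ∨ WeakNeumann u₁ ∧ WeakNeumann u₂)
    (htr : ∀ x ∈ freeSurface, u₁ (x : ℂ) = u₂ (x : ℂ)) : EqOn u₁ u₂ (closure fluidDomain) := by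
  -- The traces are prescribed only for `|x| > 1`; continuity adds the corners `±1`.
  have htr' : ∀ x : ℝ, 1 ≤ |x| → u₁ (x : ℂ) = u₂ (x : ℂ) := fun x hx =>
    eq_on_closed_freeSurface b₁.1 b₂.1 htr hx
  intro z hz
  refine le_antisymm (sub_nonpos.1 ?_) (sub_nonpos.1 ?_)
  · refine nonpos_of_homogeneous (b₁.sub b₂) (h₁.sub h₂) ?_
      (fun x hx => sub_eq_zero.2 (htr' x hx)) hz
    exact hN.imp (fun h => h.1.sub h.2) (fun h => h.1.sub b₁.1 b₂.1 h.2)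
  · refine nonpos_of_homogeneous (b₂.sub b₁) (h₂.sub h₁) ?_
      (fun x hx => sub_eq_zero.2 (htr' x hx).symm) hz
    exact hN.imp (fun h => h.2.sub h.1) (fun h => h.2.sub b₂.1 b₁.1 h.1)

end Uniqueness

end FloatingBody

/-! ### The main theorem -/

theorem mainTheorem3 (v : ℝ → ℝ) (hv : FloatingBody.MemW12 FloatingBody.freeSurface v) :
    -- `w` is the continuous representative of `v` on the closure of the free surface
    ∃ w : ℝ → ℝ, ContinuousOn w (closure FloatingBody.freeSurface) ∧
      v =ᵐ[volume.restrict FloatingBody.freeSurface] w ∧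
      -- existence
      FloatingBody.IsClassicalSolution w (FloatingBody.dirichletOmega w) ∧
      FloatingBody.IsWeakSolution w (FloatingBody.dirichletOmega w) ∧
      -- uniqueness
      (∀ Φ : ℂ → ℝ, FloatingBody.IsClassicalSolution w Φ ∨ FloatingBody.IsWeakSolution w Φ →
        EqOn Φ (FloatingBody.dirichletOmega w) (closure FloatingBody.fluidDomain)) ∧
      -- the solution is the restriction of the half-plane Poisson extension of the symmetric
      -- extension of `w`, which inside the unit disc is its reflection in the circle
      EqOn (FloatingBody.dirichletOmega w)
        (FloatingBody.dirichletHalfPlane (FloatingBody.symmExtension w))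
        (closure FloatingBody.fluidDomain) ∧
      (∀ x y : ℝ, 0 ≤ y → 0 < x ^ 2 + y ^ 2 → x ^ 2 + y ^ 2 < 1 →
        FloatingBody.dirichletHalfPlane (FloatingBody.symmExtension w) ⟨x, y⟩ =
          FloatingBody.dirichletOmega w
            ⟨x / (x ^ 2 + y ^ 2), y / (x ^ 2 + y ^ 2)⟩) := by
  obtain ⟨w, hw, hvw, C, hC⟩ := hv.exists_representative
  have hcl := FloatingBody.isClassicalSolution_dirichletOmega hw hC
  have hwk := FloatingBody.isWeakSolution_dirichletOmega hw hC
  refine ⟨w, hw, hvw, hcl, hwk, ?_, FloatingBody.eqOn_dirichletOmega_dirichletHalfPlane hw hC,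
    fun x y hy h0 h1 =>
      FloatingBody.dirichletHalfPlane_symmExtension_eq_inversion hw hC hy h0 h1⟩
  rintro Φ (h | h)
  · exact FloatingBody.eqOn_of_neumann h.continuousBounded hcl.continuousBounded h.harmonic
      hcl.harmonic (Or.inl ⟨h.neumann, hcl.neumann⟩)
      fun x hx => (h.trace x hx).trans (hcl.trace x hx).symm
  · exact FloatingBody.eqOn_of_neumann h.continuousBounded hwk.continuousBounded h.harmonic
      hwk.harmonic (Or.inr ⟨h.neumann, hwk.neumann⟩)
      fun x hx => (h.trace x hx).trans (hwk.trace x hx).symm
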